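/- Let $L$ be a set of integers, all at least $2$, with largest element $k$. For a positive integer $n$ let $\vec{c}(L,n)$ denote the maximum number of directed cycles in an $n$-vertex directed graph without loops and multiple arcs (two opposite arcs between the same two vertices are allowed), provided that the length (number of arcs) of every directed cycle of the graph belongs to $L$. Then, for $L$ fixed and $n\to\infty$, \[ \vec{c}(L,n)=\left(\frac{n-1}{k-1}\right)^{k-1}+O(n^{k-2}), \] where the implied constant may depend on $L$. -/

import Mathlib

namespace Digraph

variable {V : Type*}

/-- A directed cycle of `G`: a nonempty cyclic sequence of pairwise distinct vertices (a list of
vertices up to rotation), each joined by an arc to the next one, and the last one to the first.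
Its length as a cyclic sequence is its number of arcs. -/
def IsDirectedCycle (G : Digraph V) (c : Cycle V) : Prop :=
  c ≠ Cycle.nil ∧ c.Nodup ∧ c.Chain G.Adj

/-- The set of all directed cycles of `G`. -/
def directedCycles (G : Digraph V) : Set (Cycle V) :=
  {c | G.IsDirectedCycle c}

/-- `G` is an `L`-cycle digraph: it has no loops (nor multiple arcs, since `Adj` is a relation;
opposite arcs `u → v`, `v → u` are allowed), and all its directed cycles have length in `L`. -/
def IsLCycleDigraph (G : Digraph V) (L : Set ℕ) : Prop :=
  (∀ v, ¬ G.Adj v v) ∧ ∀ c ∈ G.directedCycles, c.length ∈ L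

end Digraph

/-- The numbers of directed cycles of the `n`-vertex `L`-cycle digraphs. -/
def directedCycleCounts (L : Set ℕ) (n : ℕ) : Set ℕ :=
  {m | ∃ G : Digraph (Fin n), G.IsLCycleDigraph L ∧ G.directedCycles.ncard = m}

/-- The maximum number of directed cycles in an `n`-vertex `L`-cycle digraph. -/
noncomputable def maxDirectedCycles (L : Set ℕ) (n : ℕ) : ℕ :=
  sSup (directedCycleCounts L n)

/-- A finite digraph has finitely many directed cycles, so that their `Set.ncard` is
their number. -/
theorem Digraph.finite_directedCycles {V : Type*} [Finite V] (G : Digraph V) :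
    G.directedCycles.Finite := by
  classical
  have := Fintype.ofFinite V
  refine Set.Finite.subset
    (Set.toFinite (Set.range (fun c : {c : Cycle V // c.Nodup} => c.1))) ?_
  rintro c ⟨-, hc, -⟩
  exact ⟨⟨c, hc⟩, rfl⟩

/-- The maximum is attained: the supremum above is over a nonempty bounded set. -/
theorem isGreatest_maxDirectedCycles (L : Set ℕ) (n : ℕ) :
    IsGreatest (directedCycleCounts L n) (maxDirectedCycles L n) := by
  have hfin : (directedCycleCounts L n).Finite := by
    refine (Set.finite_range
      (fun G : Digraph (Fin n) => G.directedCycles.ncard)).subset ?_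
    rintro m ⟨G, -, rfl⟩
    exact ⟨G, rfl⟩
  have hne : (directedCycleCounts L n).Nonempty := by
    refine ⟨_, (⟨fun _ _ => False⟩ : Digraph (Fin n)), ⟨fun _ h => h, ?_⟩, rfl⟩
    rintro c ⟨h0, -, hc⟩
    induction c using Cycle.induction_on with
    | nil => exact absurd rfl h0
    | cons a l _ =>
      rw [Cycle.chain_coe_cons] at hc
      cases l <;> simp at hc
  exact ⟨Nat.sSup_mem hne hfin.bddAbove, fun m hm => le_csSup hfin.bddAbove hm⟩

/-! Lower bound: put one vertex in layer 0, spread the others evenly over `k - 1` further layers,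
and draw all arcs from each layer to the cyclically next. Every cycle has length `k`, and each
choice of one vertex per layer gives a cycle.

Upper bound: only "no cycle is longer than `k`" and "no cycle is shorter than 2" are used. The
engine is `CircumferenceLE.false_of_extension`: a path that can always be prolonged while avoiding
`k` given vertices would become arbitrarily long. Any family of cycles too flexible for the
circumference yields such a path. Hence cycles shorter than `k` are negligible, and outside `O(n ^
(k - 2))` exceptions a `k`-cycle has a rotation in a core, where every vertex except the root has
many substitutes (`exists_heavy_off_one`).

In a core, the flexible vertices let walks through roots be made disjoint, so a vertex keeps its
position among cycles with a given root (`position_unique`), and branches of different roots are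
almost disjoint (`eq_of_mem_branch`, `sum_card_branch_le`). By AM-GM a root with `b` branch vertices
carries at most `(b / (k - 1)) ^ (k - 1)` cycles. As the branch sizes sum to at most `n` up to a
bounded loss per root, superadditivity of powers gives the bound. For `k = 2` the same path argument
shows that there are at most `n` cycles. -/

namespace Digraph

/-! ### Walks and the longest path argument -/

variable {V : Type*}

/-- `G.WalkVia u l v`: listing the vertices visited after `u`, `l` describes a walk of `G` from `u`
to `v`; its length is `l.length`. -/
inductive WalkVia (G : Digraph V) : V → List V → V → Prop
  | nil (u : V) : WalkVia G u [] u
  | cons {u v w : V} {l : List V} : G.Adj u v → WalkVia G v l w → WalkVia G u (v :: l) w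

namespace WalkVia

variable {G : Digraph V} {u v w : V} {l l₁ l₂ : List V}

theorem single (h : G.Adj u v) : G.WalkVia u [v] v := .cons h (.nil v)

theorem append (h₁ : G.WalkVia u l₁ v) (h₂ : G.WalkVia v l₂ w) : G.WalkVia u (l₁ ++ l₂) w := by
  induction h₁ with
  | nil => exact h₂
  | cons h _ ih => exact .cons h (ih h₂)

theorem split (h : G.WalkVia u (l₁ ++ v :: l₂) w) :
    G.WalkVia u (l₁ ++ [v]) v ∧ G.WalkVia v l₂ w := by
  induction l₁ generalizing u with
  | nil =>
    cases h with
    | cons h h' => exact ⟨single h, h'⟩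
  | cons a l ih =>
    cases h with
    | cons h h' => exact ⟨.cons h (ih h').1, (ih h').2⟩

theorem isChain_concat (h : G.WalkVia u l v) (hw : G.Adj v w) :
    List.IsChain G.Adj (u :: (l ++ [w])) := by
  induction h with
  | nil => simpa using hw
  | cons h _ ih => exact List.IsChain.cons_cons h (ih hw)

end WalkVia

/-- A closed walk without repeated vertices is a directed cycle. -/
theorem WalkVia.isDirectedCycle {G : Digraph V} {u : V} {l : List V} (h : G.WalkVia u l u)
    (hl : l ≠ []) (hn : l.Nodup) : G.IsDirectedCycle (l : Cycle V) := by
  refine ⟨by simpa using hl, hn, ?_⟩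
  cases h with
  | nil => exact absurd rfl hl
  | @cons _ v _ l h h' =>
    rw [Cycle.chain_coe_cons]
    exact h'.isChain_concat h

/-- All directed cycles of `G` have length at most `k`. -/
def CircumferenceLE (G : Digraph V) (k : ℕ) : Prop :=
  ∀ c ∈ G.directedCycles, c.length ≤ k

theorem CircumferenceLE.length_le {G : Digraph V} {k : ℕ} (hG : G.CircumferenceLE k) {u : V}
    {l : List V} (h : G.WalkVia u l u) (hn : l.Nodup) : l.length ≤ k := by
  by_cases hl : l = []
  · simp [hl]
  · exact hG _ (h.isDirectedCycle hl hn)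

/-- A longest path argument: if from each vertex with property `Φ` one can go on to a vertex with
property `Φ` while avoiding any given `k` vertices, then `G` has a directed cycle longer
than `k`. -/
theorem CircumferenceLE.false_of_extension [Finite V] {G : Digraph V} {k : ℕ}
    (hG : G.CircumferenceLE k) (hk : 1 ≤ k) (Φ : V → Prop) (hne : ∃ w, Φ w)
    (hext : ∀ w, Φ w → ∀ S : Finset V, w ∈ S → S.card ≤ k →
      ∃ l w', G.WalkVia w l w' ∧ l ≠ [] ∧ l.Nodup ∧ (∀ y ∈ l, y ∉ S) ∧ Φ w') : False := by
  classical
  have := Fintype.ofFinite V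
  have key : ∀ N : ℕ, ∃ s P w, G.WalkVia s P w ∧ P.Nodup ∧ Φ w ∧ N ≤ P.length := by
    intro N
    induction N with
    | zero =>
      obtain ⟨w, hw⟩ := hne
      exact ⟨w, [], w, .nil w, List.nodup_nil, hw, le_rfl⟩
    | succ N ih =>
      obtain ⟨s, P, w, hP, hPn, hw, hN⟩ := ih
      -- Avoiding the last `k` entries of `P` is enough: a return to an earlier entry would close a
      -- cycle longer than `k`.
      set Q := P.drop (P.length - k) with hQ
      have hQl : Q.length ≤ k := by simp only [hQ, List.length_drop]; omega
      -- `w` is the last entry of `P`, so inserting it adds nothing, except for empty `P`, where the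
      -- set is `{w}` and `1 ≤ k` is needed.
      obtain ⟨l, w', hl, hl0, hln, hlS, hw'⟩ := hext w hw (insert w Q.toFinset) (by simp) (by
        by_cases hP0 : P = []
        · subst hP0; simpa [hQ] using hk
        · have hwP : w ∈ Q := by
            obtain ⟨P', x, rfl⟩ : ∃ P' x, P = P' ++ [x] :=
              ⟨_, _, (List.dropLast_append_getLast hP0).symm⟩
            have : w = x := by
              have := (WalkVia.split hP).2
              cases this; rfl
            subst this
            rw [hQ, List.drop_append_of_le_length (by simp; omega)]
            simp
          rw [Finset.insert_eq_of_mem (by simpa using hwP)]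
          exact (List.toFinset_card_le _).trans hQl)
      by_cases hd : ∃ y ∈ l, y ∈ P
      · exfalso
        obtain ⟨l₁, y, l₂, rfl, hy, hl₁⟩ : ∃ l₁ y l₂, l = l₁ ++ y :: l₂ ∧ y ∈ P ∧
            ∀ z ∈ l₁, z ∉ P := by
          clear hl hl0 hln hlS hw'
          induction l with
          | nil => simp at hd
          | cons a l ih =>
            by_cases ha : a ∈ P
            · exact ⟨[], a, l, rfl, ha, by simp⟩
            · obtain ⟨l₁, y, l₂, rfl, h1, h2⟩ := ih (by simpa [ha] using hd)
              refine ⟨a :: l₁, y, l₂, rfl, h1, ?_⟩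
              simpa [ha] using h2
        obtain ⟨P₁, P₂, rfl⟩ := List.append_of_mem hy
        have hc := hG.length_le ((WalkVia.split hP).2.append (WalkVia.split hl).1) (by
          rw [List.nodup_append] at hPn hln ⊢
          have h1 := hPn.2.1
          rw [List.nodup_cons] at h1
          refine ⟨h1.2, ?_, ?_⟩
          · rw [List.nodup_append]
            refine ⟨hln.1, by simp, ?_⟩
            simp only [List.mem_singleton]
            rintro a ha b rfl
            exact hln.2.2 a ha b (by simp)
          · intro a ha b hb
            simp only [List.mem_append, List.mem_singleton] at hb
            rcases hb with hb | rfl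
            · rintro rfl
              exact hl₁ _ hb (by simp [ha])
            · rintro rfl
              exact h1.1 ha)
        simp only [List.length_append, List.length_singleton] at hc
        refine hlS y (by simp) ?_
        have : y ∈ Q := by
          rw [hQ, List.drop_append_of_le_length (by simp; omega)]
          simp
        simp [this]
      · refine ⟨s, P ++ l, w', hP.append hl, ?_, hw', ?_⟩
        · rw [List.nodup_append]
          refine ⟨hPn, hln, ?_⟩
          rintro a ha b hb rfl
          exact hd ⟨a, hb, ha⟩
        · have := List.length_pos_of_ne_nil hl0
          simp; omega
  obtain ⟨s, P, w, -, hPn, -, hN⟩ := key (Fintype.card V + 1)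
  have := hPn.length_le_card
  omega

end Digraph

/-! ### Pruning finite families -/

/-- If a finite family `F` has more than `D` times as many members as there are tests met by `F`,
then it has a nonempty subfamily in which each test is met by no member or by more than `D`. -/
theorem Finset.exists_subset_forall_lt_card_filter {α β : Type*} (F : Finset α)
    (t : Finset β) (r : α → β → Prop) [∀ a b, Decidable (r a b)] (D : ℕ)
    (h : D * t.card < F.card) :
    ∃ F' ⊆ F, F'.Nonempty ∧ ∀ a ∈ F', ∀ b ∈ t, r a b → D < (F'.filter (r · b)).card := by
  classical
  induction F using Finset.strongInduction generalizing t with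
  | H F ih =>
    by_cases hF : ∀ a ∈ F, ∀ b ∈ t, r a b → D < (F.filter (r · b)).card
    · exact ⟨F, Subset.rfl, Finset.card_pos.1 (by omega), hF⟩
    -- Discard a violated test with the members meeting it: at least one, at most `D`. Both sides of
    -- the inequality drop, the left by `D` and the right by at most `D`.
    push Not at hF
    obtain ⟨a, ha, b, hb, hab, hD⟩ := hF
    have h1 := Finset.card_filter_add_card_filter_not (s := F) (r · b)
    have h2 := Finset.card_erase_add_one hb
    have hss : F.filter (¬ r · b) ⊂ F := by
      refine Finset.filter_ssubset.2 ⟨a, ha, by simpa using hab⟩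
    obtain ⟨F', hF', hne, hall⟩ := ih _ hss (t.erase b) (by
      rw [← h2] at h
      nlinarith)
    refine ⟨F', hF'.trans hss.1, hne, fun a' ha' b' hb' hr => ?_⟩
    refine hall a' ha' b' (Finset.mem_erase.2 ⟨?_, hb'⟩) hr
    rintro rfl
    exact (Finset.mem_filter.1 (hF' ha')).2 hr

/-- Among more than `D` functions agreeing off `i`, one avoids `D` given values at `i`. -/
theorem Finset.exists_notMem_of_lt_card_filter {ι V : Type*} [DecidableEq ι] [DecidableEq V]
    [Fintype ι]
    {F : Finset (ι → V)} {a : ι → V} {i : ι} {D : ℕ} {S : Finset V}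
    (h : D < (F.filter fun b => ∀ j, j ≠ i → b j = a j).card) (hS : S.card ≤ D) :
    ∃ b ∈ F, (∀ j, j ≠ i → b j = a j) ∧ b i ∉ S := by
  by_contra! hcon
  have : (F.filter fun b => ∀ j, j ≠ i → b j = a j).card ≤ S.card := by
    refine Finset.card_le_card_of_injOn (fun b => b i) ?_ ?_
    · intro b hb
      simp only [Finset.coe_filter, Set.mem_ofPred_eq] at hb
      exact hcon b hb.1 hb.2
    · intro b hb c hc hbc
      simp only [Finset.coe_filter, Set.mem_ofPred_eq] at hb hc
      funext j
      by_cases hj : j = i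
      · subst hj; exact hbc
      · rw [hb.2 j hj, hc.2 j hj]
  omega

/-! ### Rooted cycles and their rotations -/

namespace Digraph

variable {V : Type*}

/-- A directed cycle of length `k` with a starting vertex, as a cyclic enumeration of its
vertices. -/
def IsRootedCycle (G : Digraph V) {k : ℕ} (a : ZMod k → V) : Prop :=
  Function.Injective a ∧ ∀ i, G.Adj (a i) (a (i + 1))

/-- The `s` values of `a` that follow `a q`. -/
def segment {k : ℕ} (a : ZMod k → V) (q : ZMod k) (s : ℕ) : List V :=
  (List.range s).map fun t : ℕ => a (q + 1 + (t : ZMod k))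

@[simp]
theorem length_segment {k : ℕ} (a : ZMod k → V) (q : ZMod k) (s : ℕ) :
    (segment a q s).length = s := by
  simp [segment]

theorem mem_segment {k : ℕ} {a : ZMod k → V} {q : ZMod k} {s : ℕ} {y : V} :
    y ∈ segment a q s ↔ ∃ t < s, a (q + 1 + (t : ZMod k)) = y := by
  simp [segment]

theorem segment_succ {k : ℕ} (a : ZMod k → V) (q : ZMod k) (s : ℕ) :
    segment a q (s + 1) = segment a q s ++ [a (q + 1 + (s : ZMod k))] := by
  simp [segment, List.range_succ]

theorem natCast_zmod_inj {k s t : ℕ} (hs : s < k) (ht : t < k)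
    (h : (s : ZMod k) = (t : ZMod k)) : s = t := by
  rw [ZMod.natCast_eq_natCast_iff'] at h
  rwa [Nat.mod_eq_of_lt hs, Nat.mod_eq_of_lt ht] at h

namespace IsRootedCycle

variable {G : Digraph V} {k : ℕ} {a : ZMod k → V}

theorem walkVia_segment (h : G.IsRootedCycle a) (q : ZMod k) (s : ℕ) :
    G.WalkVia (a q) (segment a q s) (a (q + s)) := by
  induction s with
  | zero => simpa [segment] using WalkVia.nil (a q)
  | succ s ih =>
    rw [segment_succ]
    have := h.2 (q + s)
    rw [show q + 1 + (s : ZMod k) = q + s + 1 by ring,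
      show q + ((s + 1 : ℕ) : ZMod k) = q + s + 1 by push_cast; ring]
    exact ih.append (.single this)

theorem nodup_segment (h : G.IsRootedCycle a) (q : ZMod k) {s : ℕ} (hs : s ≤ k) :
    (segment a q s).Nodup := by
  refine List.Nodup.map_on ?_ List.nodup_range
  intro x hx y hy hxy
  rw [List.mem_range] at hx hy
  exact natCast_zmod_inj (k := k) (by omega) (by omega) (by simpa using h.1 hxy)

theorem rotate (h : G.IsRootedCycle a) (r : ZMod k) : G.IsRootedCycle fun i => a (i + r) := by
  refine ⟨fun i j hij => by simpa using h.1 hij, fun i => ?_⟩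
  have := h.2 (i + r)
  rwa [show i + r + 1 = i + 1 + r by ring] at this

end IsRootedCycle

/-- The directed cycle obtained by forgetting the starting vertex. -/
def toCycle {k : ℕ} (a : ZMod k → V) : Cycle V := (segment a 0 k : Cycle V)

theorem IsRootedCycle.toCycle_mem {G : Digraph V} {k : ℕ} [NeZero k] {a : ZMod k → V}
    (h : G.IsRootedCycle a) : toCycle a ∈ G.directedCycles := by
  have h1 := h.walkVia_segment 0 k
  rw [ZMod.natCast_self, add_zero] at h1
  refine h1.isDirectedCycle ?_ (h.nodup_segment 0 le_rfl)
  intro h0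
  have := congrArg List.length h0
  simp [NeZero.ne k] at this

theorem segment_rotate {k : ℕ} [NeZero k] (a : ZMod k → V) (r : ℕ) :
    (segment a 0 k).rotate r = segment (fun i => a (i + (r : ZMod k))) 0 k := by
  refine List.ext_getElem (by simp) fun n h1 h2 => ?_
  rw [List.getElem_rotate]
  simp only [segment, List.getElem_map, List.getElem_range, List.length_map, List.length_range,
    ZMod.natCast_mod]
  congr 1
  push_cast
  ring

theorem toCycle_rotate {k : ℕ} [NeZero k] (a : ZMod k → V) (r : ZMod k) :
    toCycle (fun i => a (i + r)) = toCycle a := by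
  rw [toCycle, toCycle, Cycle.coe_eq_coe]
  refine List.IsRotated.symm ⟨r.val, ?_⟩
  rw [segment_rotate]
  simp

theorem segment_injective {k : ℕ} [NeZero k] {a b : ZMod k → V}
    (h : segment a 0 k = segment b 0 k) : a = b := by
  funext i
  have h1 : ∀ t < k, a (0 + 1 + (t : ZMod k)) = b (0 + 1 + (t : ZMod k)) := by
    have := List.map_inj_left.1 h
    simpa using this
  have := h1 (i - 1).val (ZMod.val_lt _)
  simpa using this

/-- Equal cycles differ by a rotation, and by injectivity only the trivial rotation fixes the root.
-/
theorem IsRootedCycle.eq_of_toCycle_eq {G : Digraph V} {k : ℕ} [NeZero k] {a b : ZMod k → V}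
    (ha : G.IsRootedCycle a) (h : toCycle a = toCycle b) (h0 : a 0 = b 0) : a = b := by
  rw [toCycle, toCycle, Cycle.coe_eq_coe] at h
  obtain ⟨r, hr⟩ := h
  rw [segment_rotate] at hr
  have hr := segment_injective hr
  have h1 := congrFun hr 0
  have h2 : (0 : ZMod k) + r = 0 := ha.1 (by rw [h0]; exact h1)
  rw [← hr]
  rw [zero_add] at h2
  simp [h2]

theorem exists_isRootedCycle {G : Digraph V} {k : ℕ} [NeZero k] {c : Cycle V}
    (hc : c ∈ G.directedCycles) (hk : c.length = k) :
    ∃ a : ZMod k → V, G.IsRootedCycle a ∧ toCycle a = c := by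
  obtain ⟨-, hn, hch⟩ := hc
  induction c using Quotient.inductionOn' with
  | h l =>
    change (l : Cycle V).length = k at hk
    change (l : Cycle V).Nodup at hn
    change (l : Cycle V).Chain G.Adj at hch
    rw [Cycle.length_coe] at hk
    rw [Cycle.nodup_coe_iff] at hn
    have hlt : ∀ i : ZMod k, i.val < l.length := fun i => by rw [hk]; exact ZMod.val_lt i
    -- The shift by one is there because `segment a 0 k` starts at `a 1` and ends at `a 0`.
    refine ⟨fun i => l[(i - 1).val]'(hlt _), ⟨?_, ?_⟩, ?_⟩
    · intro i j hij
      have := (hn.getElem_inj_iff).1 hij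
      simpa using ZMod.val_injective k this
    · intro i
      simp only [add_sub_cancel_right]
      obtain ⟨j, rfl⟩ : ∃ j, i = j + 1 := ⟨i - 1, by ring⟩
      simp only [add_sub_cancel_right]
      obtain _ | ⟨x, m⟩ := l
      · simp at hk; exact absurd hk.symm (NeZero.ne k)
      rw [Cycle.chain_coe_cons, List.isChain_iff_getElem] at hch
      have hj := hlt j
      have h1 := hch j.val (by simpa using hj)
      have e1 : ∀ h, (x :: (m ++ [x]))[j.val]'h = (x :: m)[j.val]'hj := by
        intro h
        have := List.getElem_append_left (bs := [x]) hj (h' := by simp at hj ⊢; omega)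
        simpa using this
      rw [e1] at h1
      by_cases hj' : j.val + 1 < k
      · have hv : (j + 1).val = j.val + 1 := by
          rw [ZMod.val_add, ZMod.val_one'' (by omega), Nat.mod_eq_of_lt hj']
        simp only [hv]
        have e2 : ∀ h, (x :: (m ++ [x]))[j.val + 1]'h =
            (x :: m)[j.val + 1]'(by rw [hk]; exact hj') := by
          intro h
          have := List.getElem_append_left (as := x :: m) (bs := [x]) (i := j.val + 1)
            (by rw [hk]; exact hj') (h' := by simp at hj ⊢; omega)
          simpa using this
        rwa [e2] at h1
      · have hjk : j.val + 1 = k := by have := ZMod.val_lt j; omega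
        have hv : j + 1 = 0 := by
          have := congrArg (Nat.cast : ℕ → ZMod k) hjk
          simpa using this
        simp only [hv, ZMod.val_zero, List.getElem_cons_zero]
        have e2 : ∀ h, (x :: (m ++ [x]))[j.val + 1]'h = x := by
          intro h
          have hm : j.val = m.length := by simp at hk; omega
          simp [hm]
        rwa [e2] at h1
    · change ((segment _ 0 k : List V) : Cycle V) = (l : Cycle V)
      congr 1
      refine List.ext_getElem (by simp [hk]) fun n h1 h2 => ?_
      simp only [segment, List.getElem_map, List.getElem_range]
      congr 1
      rw [zero_add, add_sub_cancel_left, ZMod.val_natCast, Nat.mod_eq_of_lt (by omega)]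

end Digraph

/-! ### Families in which values can be changed on given sets of positions -/

section Heavy

variable {ι V : Type*} [Fintype ι] [DecidableEq ι] [DecidableEq V]

/-- A finite family of functions that is large compared with the numbers of its restrictions to
the complements of the sets `J ∈ I` contains a nonempty subfamily each member of which agrees off
any `J ∈ I` with more than `D` members. -/
theorem Finset.exists_subset_forall_lt_card_agree (F : Finset (ι → V))
    (I : Finset (Finset ι)) (D : ℕ)
    (h : D * ∑ J ∈ I, (F.image fun a (j : {j // j ∉ J}) => a j).card < F.card) :
    ∃ F' ⊆ F, F'.Nonempty ∧ ∀ a ∈ F', ∀ J ∈ I,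
      D < (F'.filter fun b => ∀ j, j ∉ J → b j = a j).card := by
  classical
  obtain ⟨F', hF', hne, hall⟩ := F.exists_subset_forall_lt_card_filter
    (I.sigma fun J => F.image fun a (j : {j // j ∉ J}) => a j)
    (fun a (t : Σ J : Finset ι, ({j // j ∉ J} → V)) => ∀ j : {j // j ∉ t.1}, a j = t.2 j) D (by rwa [Finset.card_sigma])
  refine ⟨F', hF', hne, fun a ha J hJ => ?_⟩
  have := hall a ha ⟨J, fun j => a j⟩
    (Finset.mem_sigma.2 ⟨hJ, Finset.mem_image_of_mem _ (hF' ha)⟩) (fun _ => rfl)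
  simpa using this

theorem Finset.card_image_restrict_le [Fintype V] (F : Finset (ι → V)) (J : Finset ι) :
    (F.image fun a (j : {j // j ∉ J}) => a j).card
      ≤ Fintype.card V ^ (Fintype.card ι - J.card) := by
  refine (Finset.card_le_univ _).trans (le_of_eq ?_)
  rw [Fintype.card_fun, Fintype.card_subtype_compl]
  simp

end Heavy

/-! ### Light and heavy positions in families of cycles -/

namespace Digraph

variable {V : Type*} [Fintype V] [DecidableEq V] {G : Digraph V} {k : ℕ}

/-- The bound `k * (j * n ^ (j - 1))` on the number of rooted cycles of length `j`. -/
theorem CircumferenceLE.card_rooted_le (hG : G.CircumferenceLE k) {j : ℕ} [NeZero j]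
    (hj : 2 ≤ j) (hk : 1 ≤ k) (F : Finset (ZMod j → V)) (hF : ∀ a ∈ F, G.IsRootedCycle a) :
    F.card ≤ k * (j * Fintype.card V ^ (j - 1)) := by
  by_contra! hcon
  obtain ⟨F', hF', ⟨a₀, ha₀⟩, hall⟩ := F.exists_subset_forall_lt_card_agree
    (Finset.univ.image fun i => {i}) k (by
      refine lt_of_le_of_lt ?_ hcon
      refine Nat.mul_le_mul_left _ ?_
      refine (Finset.sum_le_card_nsmul _ _ (Fintype.card V ^ (j - 1)) ?_).trans ?_
      · intro J hJ
        obtain ⟨i, -, rfl⟩ := Finset.mem_image.1 hJ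
        simpa using F.card_image_restrict_le {i}
      · rw [smul_eq_mul]
        refine Nat.mul_le_mul_right _ (Finset.card_image_le.trans ?_)
        simp)
  -- Since every position is heavy, the successor of `a q` can always be exchanged for a vertex
  -- outside `S`.
  refine hG.false_of_extension hk (fun w => ∃ a ∈ F', ∃ q, a q = w) ⟨_, a₀, ha₀, 0, rfl⟩ ?_
  rintro w ⟨a, ha, q, rfl⟩ S - hS
  have h1 := hall a ha {q + 1} (Finset.mem_image_of_mem _ (Finset.mem_univ _))
  simp only [Finset.mem_singleton] at h1
  obtain ⟨b, hb, hba, hbS⟩ := Finset.exists_notMem_of_lt_card_filter h1 hS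
  have : Fact (1 < j) := ⟨by omega⟩
  refine ⟨[b (q + 1)], b (q + 1), .single ?_, by simp, by simp, by simpa using hbS, b, hb, _, rfl⟩
  rw [← hba q (by simp)]
  exact (hF b (hF' hb)).2 q

/-- A large family of `k`-tuples has a nonempty subfamily and a set `T` of positions such that the
members of the subfamily are determined off any position of `T`, while any other
position, and any pair of positions in `T`, can be changed in more than `D` ways. -/
theorem exists_light_heavy [NeZero k] {D : ℕ} (hD : 1 ≤ D) (hk : 2 ≤ k) (F : Finset (ZMod k → V))
    (hF : (2 * k * D) ^ k * (2 * D * k ^ 2 * Fintype.card V ^ (k - 2)) < F.card) :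
    ∃ T : Finset (ZMod k), ∃ F' ⊆ F, F'.Nonempty ∧
      (∀ i ∈ T, ∀ a ∈ F', ∀ b ∈ F', (∀ j, j ≠ i → b j = a j) → b = a) ∧
      (∀ a ∈ F', ∀ i ∉ T, D < (F'.filter fun b => ∀ j, j ≠ i → b j = a j).card) ∧
      (∀ a ∈ F', ∀ i ∈ T, ∀ i' ∈ T, i ≠ i' →
        D < (F'.filter fun b => ∀ j, j ≠ i → j ≠ i' → b j = a j).card) := by
  classical
  set c := 2 * k * D with hc
  have hc1 : 1 ≤ c := by
    have : 0 < 2 * k * D := by positivity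
    omega
  -- Making one more position light may cost a factor `c`. `T` is taken as large as these losses
  -- permit.
  let P : Finset (ZMod k) → Prop := fun T => ∃ F' ⊆ F,
    (∀ i ∈ T, ∀ a ∈ F', ∀ b ∈ F', (∀ j, j ≠ i → b j = a j) → b = a) ∧
    F.card ≤ c ^ T.card * F'.card
  obtain ⟨T, hT, hmax⟩ := Finset.exists_max_image (Finset.univ.filter P) Finset.card
    ⟨∅, by simpa [P] using ⟨F, Finset.Subset.rfl, le_rfl⟩⟩
  obtain ⟨F', hF', hlight, hcard⟩ := (Finset.mem_filter.1 hT).2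
  have hTk : T.card ≤ k := by simpa using Finset.card_le_univ T
  -- Otherwise keeping one representative of each restriction off `i` would make `i` light too,
  -- against the maximality of `T`.
  have hrep : ∀ i ∉ T,
      c * (F'.image fun a (j : {j // j ∉ ({i} : Finset (ZMod k))}) => a j).card ≤ F'.card := by
    intro i hi
    by_contra! hcon
    set π := fun (a : ZMod k → V) (j : {j // j ∉ ({i} : Finset (ZMod k))}) => a j with hπ
    obtain ⟨u, hu, hinj, himg⟩ := Finset.exists_subset_injOn_image_eq_of_surjOn (f := π)
      (F' : Set (ZMod k → V)) (F'.image π) (by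
        intro x hx
        simpa using hx)
    have hu' : u ⊆ F' := by exact_mod_cast hu
    have hPi : P (insert i T) := by
      refine ⟨u, hu'.trans hF', ?_, ?_⟩
      · intro i' hi' a ha b hb hab
        rcases Finset.mem_insert.1 hi' with rfl | hi'
        · refine hinj hb ha ?_
          funext j
          exact hab j (by simpa using j.2)
        · exact hlight i' hi' a (hu' ha) b (hu' hb) hab
      · rw [Finset.card_insert_of_notMem hi, pow_succ, mul_assoc]
        refine hcard.trans (Nat.mul_le_mul_left _ ?_)
        rw [← himg, Finset.card_image_of_injOn hinj] at hcon
        exact hcon.le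
    have := hmax _ (Finset.mem_filter.2 ⟨Finset.mem_univ _, hPi⟩)
    rw [Finset.card_insert_of_notMem hi] at this
    omega
  set I₁ : Finset (Finset (ZMod k)) := (Finset.univ.filter (· ∉ T)).image fun i => {i} with hI₁
  set I₂ : Finset (Finset (ZMod k)) := T.offDiag.image fun p => {p.1, p.2} with hI₂
  -- Each kind of test takes up at most half of `F'`: the single positions by `hrep` and `c = 2 * k
  -- * D`, the pairs because there are at most `k ^ 2` of them with at most `n ^ (k - 2)`
  -- restrictions each. Lightness passes to subfamilies.
  obtain ⟨F'', hF'', hne, hall⟩ := F'.exists_subset_forall_lt_card_agree (I₁ ∪ I₂) D (by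
    set x : Finset (ZMod k) → ℕ := fun J => (F'.image fun a (j : {j // j ∉ J}) => a j).card
      with hx
    have hsum := Finset.sum_union_inter (s₁ := I₁) (s₂ := I₂) (f := x)
    have hX : 2 * D * ∑ J ∈ I₁, x J ≤ F'.card := by
      have h1 : ∑ J ∈ I₁, c * x J ≤ I₁.card • F'.card := by
        refine Finset.sum_le_card_nsmul _ _ _ ?_
        intro J hJ
        obtain ⟨i, hi, rfl⟩ := Finset.mem_image.1 hJ
        exact hrep i (Finset.mem_filter.1 hi).2
      have h2 : I₁.card ≤ k := by
        refine Finset.card_image_le.trans ((Finset.card_le_univ _).trans ?_)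
        simp
      rw [← Finset.mul_sum, smul_eq_mul] at h1
      have h3 := h1.trans (Nat.mul_le_mul_right F'.card h2)
      refine Nat.le_of_mul_le_mul_left (c := k) ?_ (by omega)
      calc k * (2 * D * ∑ J ∈ I₁, x J) = c * ∑ J ∈ I₁, x J := by rw [hc]; ring
        _ ≤ _ := h3
    have hY : 2 * D * ∑ J ∈ I₂, x J < F'.card := by
      have h1 : ∑ J ∈ I₂, x J ≤ I₂.card • Fintype.card V ^ (k - 2) := by
        refine Finset.sum_le_card_nsmul _ _ _ ?_
        intro J hJ
        obtain ⟨p, hp, rfl⟩ := Finset.mem_image.1 hJ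
        have := F'.card_image_restrict_le {p.1, p.2}
        rwa [Finset.card_pair (Finset.mem_offDiag.1 hp).2.2, ZMod.card] at this
      have h2 : I₂.card ≤ k ^ 2 := by
        refine Finset.card_image_le.trans ?_
        rw [Finset.offDiag_card, sq]
        exact (Nat.sub_le _ _).trans (Nat.mul_le_mul hTk hTk)
      have h3 : c ^ k * (2 * D * k ^ 2 * Fintype.card V ^ (k - 2)) < c ^ k * F'.card :=
        hF.trans_le (hcard.trans (Nat.mul_le_mul_right _ (Nat.pow_le_pow_right hc1 hTk)))
      have h4 := Nat.lt_of_mul_lt_mul_left h3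
      refine lt_of_le_of_lt ?_ h4
      calc 2 * D * ∑ J ∈ I₂, x J ≤ 2 * D * (k ^ 2 * Fintype.card V ^ (k - 2)) :=
            Nat.mul_le_mul_left _ (h1.trans (by
              rw [smul_eq_mul]; exact Nat.mul_le_mul_right _ h2))
        _ = _ := by ring
    have hle : ∑ J ∈ I₁ ∪ I₂, x J ≤ ∑ J ∈ I₁, x J + ∑ J ∈ I₂, x J := by omega
    have := Nat.mul_le_mul_left (2 * D) hle
    rw [mul_add] at this
    have e : 2 * D * ∑ J ∈ I₁ ∪ I₂, x J = 2 * (D * ∑ J ∈ I₁ ∪ I₂, x J) := by ring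
    change D * ∑ J ∈ I₁ ∪ I₂, x J < F'.card
    omega)
  refine ⟨T, F'', hF''.trans hF', hne, ?_, ?_, ?_⟩
  · intro i hi a ha b hb
    exact hlight i hi a (hF'' ha) b (hF'' hb)
  · intro a ha i hi
    have := hall a ha {i} (Finset.mem_union_left _
      (Finset.mem_image_of_mem _ (Finset.mem_filter.2 ⟨Finset.mem_univ _, hi⟩)))
    simpa using this
  · intro a ha i hi i' hi' hii'
    have := hall a ha {i, i'} (Finset.mem_union_right _
      (Finset.mem_image_of_mem (fun p : ZMod k × ZMod k => ({p.1, p.2} : Finset (ZMod k)))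
        (Finset.mem_offDiag.2 ⟨hi, hi', hii'⟩ : (i, i') ∈ T.offDiag)))
    simpa using this

/-- If the members of `F` are determined off `i` and off `i'`, then among more than `2 * D`
members agreeing off `{i, i'}` one avoids `D` given values at both positions. -/
theorem exists_notMem_pair {W : Type*} [DecidableEq W] [NeZero k] {F : Finset (ZMod k → W)}
    {a : ZMod k → W} {i i' : ZMod k} {D : ℕ} {S : Finset W}
    (hi : ∀ a ∈ F, ∀ b ∈ F, (∀ j, j ≠ i → b j = a j) → b = a)
    (hi' : ∀ a ∈ F, ∀ b ∈ F, (∀ j, j ≠ i' → b j = a j) → b = a)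
    (h : 2 * D < (F.filter fun b => ∀ j, j ≠ i → j ≠ i' → b j = a j).card) (hS : S.card ≤ D) :
    ∃ b ∈ F, (∀ j, j ≠ i → j ≠ i' → b j = a j) ∧ b i ∉ S ∧ b i' ∉ S := by
  by_contra! hcon
  set A := F.filter fun b => ∀ j, j ≠ i → j ≠ i' → b j = a j with hA
  have hA' : ∀ b ∈ A, b ∈ F ∧ ∀ j, j ≠ i → j ≠ i' → b j = a j := fun b hb => by
    simpa [hA] using hb
  have h1 : (A.filter fun b => b i ∈ S).card ≤ S.card := by
    refine Finset.card_le_card_of_injOn (fun b => b i) ?_ ?_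
    · intro b hb
      exact (Finset.mem_filter.1 hb).2
    · intro b hb c hc hbc
      have hb := hA' _ (Finset.mem_filter.1 hb).1
      have hc := hA' _ (Finset.mem_filter.1 hc).1
      refine hi' c hc.1 b hb.1 fun j hj => ?_
      by_cases hji : j = i
      · subst hji; exact hbc
      · rw [hb.2 j hji hj, hc.2 j hji hj]
  have h2 : (A.filter fun b => ¬ b i ∈ S).card ≤ S.card := by
    refine Finset.card_le_card_of_injOn (fun b => b i') ?_ ?_
    · intro b hb
      have hb' := hA' _ (Finset.mem_filter.1 hb).1
      exact hcon b hb'.1 hb'.2 (Finset.mem_filter.1 hb).2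
    · intro b hb c hc hbc
      have hb := hA' _ (Finset.mem_filter.1 hb).1
      have hc := hA' _ (Finset.mem_filter.1 hc).1
      refine hi c hc.1 b hb.1 fun j hj => ?_
      by_cases hji : j = i'
      · subst hji; exact hbc
      · rw [hb.2 j hj hji, hc.2 j hj hji]
  have h3 := Finset.card_filter_add_card_filter_not (s := A) fun b => b i ∈ S
  omega

/-- A large family of rooted `k`-cycles contains a nonempty subfamily in which all positions but
one can be changed in more than `D` ways. -/
theorem CircumferenceLE.exists_heavy_off_one (hG : G.CircumferenceLE k) [NeZero k] {D : ℕ}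
    (hk : 3 ≤ k) (hD : 2 * k ≤ D) (F : Finset (ZMod k → V)) (hFr : ∀ a ∈ F, G.IsRootedCycle a)
    (hF : (2 * k * D) ^ k * (2 * D * k ^ 2 * Fintype.card V ^ (k - 2)) < F.card) :
    ∃ p : ZMod k, ∃ F' ⊆ F, F'.Nonempty ∧ ∀ a ∈ F', ∀ i, i ≠ p →
      D < (F'.filter fun b => ∀ j, j ≠ i → b j = a j).card := by
  have : Fact (1 < k) := ⟨by omega⟩
  have h2 : (2 : ZMod k) ≠ 0 := by
    intro h
    have := natCast_zmod_inj (k := k) (s := 2) (t := 0) (by omega) (by omega) (by simpa using h)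
    omega
  obtain ⟨T, F', hF', hne, hlight, hheavy, hpair⟩ :=
    exists_light_heavy (by omega) (by omega) F hF
  by_cases hT : T.card ≤ 1
  · obtain ⟨p, hp⟩ := Finset.card_le_one_iff_subset_singleton.1 hT
    exact ⟨p, F', hF', hne, fun a ha i hi => hheavy a ha i fun h => hi (by simpa using hp h)⟩
  exfalso
  push Not at hT
  obtain ⟨a₀, ha₀⟩ := hne
  -- With two light positions a path can be extended forever. If `q + 1` is heavy, change it alone;
  -- if it is light, change it together with another light `j ≠ q`, which leaves `a q` in place.
  -- Such a `j` is missing only when `T = {q, q + 1}`, so the path must never stop at such a `q`.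
  refine hG.false_of_extension (by omega)
    (fun w => ∃ a ∈ F', ∃ q, a q = w ∧ T ≠ {q, q + 1}) ?_ ?_
  · by_cases h0 : T = {0, 1}
    · refine ⟨_, a₀, ha₀, 1, rfl, fun h1 => ?_⟩
      have : (0 : ZMod k) ∈ T := by simp [h0]
      rw [h1] at this
      simp only [Finset.mem_insert, Finset.mem_singleton, zero_ne_one, false_or] at this
      exact h2 (by rw [← one_add_one_eq_two]; exact this.symm)
    · exact ⟨_, a₀, ha₀, 0, rfl, by simpa using h0⟩
  rintro w ⟨a, ha, q, rfl, hq⟩ S - hS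
  have hstep : ∀ b ∈ F', ∀ q, G.Adj (b q) (b (q + 1)) := fun b hb q => (hFr b (hF' hb)).2 q
  by_cases hqT : q + 1 ∈ T
  · obtain ⟨j, hj, hjq, hjq'⟩ : ∃ j ∈ T, j ≠ q ∧ j ≠ q + 1 := by
      by_contra! hcon
      by_cases hq' : q ∈ T
      · refine hq (Finset.Subset.antisymm (fun j hj => ?_) (fun j hj => ?_))
        · have := hcon j hj
          simp only [Finset.mem_insert, Finset.mem_singleton]
          tauto
        · simp only [Finset.mem_insert, Finset.mem_singleton] at hj
          rcases hj with rfl | rfl <;> assumption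
      · have : T ⊆ {q + 1} := fun j hj => by
          simpa using hcon j hj fun h => hq' (h ▸ hj)
        have := Finset.card_le_card this
        simp at this
        omega
    obtain ⟨b, hb, hba, hb1, hbj⟩ := exists_notMem_pair (D := k) (hlight _ hqT) (hlight _ hj)
      (lt_of_le_of_lt hD (hpair a ha _ hqT _ hj hjq'.symm)) hS
    have hbq : b q = a q := hba q (by simp) hjq.symm
    -- Stopping at `q + 1` is forbidden here. Both light vertices are new, so take two steps; `q +
    -- 2` is allowed since `2 ≠ 0` in `ZMod k`.
    by_cases hT2 : T = {q + 1, q + 1 + 1}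
    · have hj2 : j = q + 1 + 1 := by
        have : j ∈ T := hj
        rw [hT2] at this
        simpa [hjq'] using this
      subst hj2
      refine ⟨[b (q + 1), b (q + 1 + 1)], b (q + 1 + 1), ?_, by simp, ?_, ?_, b, hb, _, rfl, ?_⟩
      · rw [← hbq]
        exact .cons (hstep b hb q) (.single (hstep b hb _))
      · simpa using fun h => hjq' ((hFr b (hF' hb)).1 h).symm
      · simpa using ⟨hb1, hbj⟩
      · intro h
        rw [h] at hqT
        have h3 : q + 1 = q + 1 + 1 + 1 := by simpa using hqT
        refine h2 ?_
        calc (2 : ZMod k) = q + 1 + 1 + 1 - (q + 1) := by ring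
          _ = 0 := by rw [← h3, sub_self]
    · exact ⟨[b (q + 1)], b (q + 1), by rw [← hbq]; exact .single (hstep b hb q), by simp, by simp,
        by simpa using hb1, b, hb, _, rfl, hT2⟩
  · obtain ⟨b, hb, hba, hbS⟩ := Finset.exists_notMem_of_lt_card_filter (S := S)
      (hheavy a ha _ hqT) (by omega)
    refine ⟨[b (q + 1)], b (q + 1), ?_, by simp, by simp, by simpa using hbS, b, hb, _, rfl, ?_⟩
    · rw [← hba q (by simp)]
      exact .single (hstep b hb q)
    · rintro h
      exact hqT (by rw [h]; simp)

end Digraph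

/-! ### Cores: only the root is rigid -/

namespace Digraph

variable {V : Type*} [DecidableEq V] {G : Digraph V} {k : ℕ} [NeZero k] {D : ℕ}

/-- A family of rooted cycles in each of which any vertex but the root can be changed in more than
`D` ways within the family. -/
def IsCore (G : Digraph V) (D : ℕ) (E : Finset (ZMod k → V)) : Prop :=
  ∀ a ∈ E, G.IsRootedCycle a ∧
    ∀ i, i ≠ 0 → D < (E.filter fun b => ∀ j, j ≠ i → b j = a j).card

section MaxCore

variable [Fintype V]

open Classical in
/-- The largest core of rooted `k`-cycles of `G`. -/
noncomputable def maxCore (G : Digraph V) (D k : ℕ) [NeZero k] : Finset (ZMod k → V) :=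
  Finset.univ.filter fun a => ∃ E : Finset (ZMod k → V), G.IsCore D E ∧ a ∈ E

theorem IsCore.subset_maxCore {E : Finset (ZMod k → V)} (hE : G.IsCore D E) :
    E ⊆ G.maxCore D k := fun a ha => by
  simpa [maxCore] using ⟨E, hE, ha⟩

/-- The number of substitutes only grows with the family, so a union of cores is a core. -/
theorem isCore_maxCore : G.IsCore D (G.maxCore D k) := by
  intro a ha
  obtain ⟨E, hE, haE⟩ : ∃ E : Finset (ZMod k → V), G.IsCore D E ∧ a ∈ E := by
    simpa [maxCore] using ha
  refine ⟨(hE a haE).1, fun i hi => ((hE a haE).2 i hi).trans_le ?_⟩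
  exact Finset.card_le_card (Finset.filter_subset_filter _ hE.subset_maxCore)

end MaxCore

namespace IsCore

variable {E : Finset (ZMod k → V)}

/-- The positions in `J` are changed one at a time, each change staying in `E` and leaving the
earlier ones intact. -/
theorem exists_notMem (hE : G.IsCore D E) {a : ZMod k → V} (ha : a ∈ E) {S : Finset V}
    (hS : S.card ≤ D) (J : Finset (ZMod k)) (hJ : 0 ∉ J) :
    ∃ b ∈ E, (∀ j ∉ J, b j = a j) ∧ ∀ j ∈ J, b j ∉ S := by
  induction J using Finset.induction_on with
  | empty => exact ⟨a, ha, by simp⟩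
  | insert i J hi ih =>
    simp only [Finset.mem_insert, not_or] at hJ
    obtain ⟨b, hb, hba, hbS⟩ := ih hJ.2
    obtain ⟨c, hc, hcb, hcS⟩ :=
      Finset.exists_notMem_of_lt_card_filter ((hE b hb).2 i (Ne.symm hJ.1)) hS
    refine ⟨c, hc, fun j hj => ?_, fun j hj => ?_⟩
    · simp only [Finset.mem_insert, not_or] at hj
      rw [hcb j hj.1, hba j hj.2]
    · by_cases hji : j = i
      · rwa [hji]
      · rw [hcb j hji]
        exact hbS j ((Finset.mem_insert.1 hj).resolve_left hji)

/-- From the root of a member of a core one can walk to its `i`-th vertex, in `i` steps, with all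
intermediate vertices off a given small set. -/
theorem exists_walkVia_from_root (hE : G.IsCore D E) {a : ZMod k → V} (ha : a ∈ E) {i : ZMod k}
    (hi : i ≠ 0) {S : Finset V} (hS : S.card ≤ D) :
    ∃ l, G.WalkVia (a 0) (l ++ [a i]) (a i) ∧ l.length + 1 = i.val ∧ l.Nodup ∧
      ∀ y ∈ l, y ∉ S := by
  obtain ⟨b, hb, hba, hbS⟩ := hE.exists_notMem ha hS {0, i}ᶜ (by simp)
  have hb0 : b 0 = a 0 := hba 0 (by simp)
  have hbi : b i = a i := hba i (by simp)
  have hbr := (hE b hb).1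
  have hlt := ZMod.val_lt i
  have hpos : i.val ≠ 0 := by simpa using hi
  have hw := hbr.walkVia_segment 0 i.val
  obtain ⟨s, hs⟩ := Nat.exists_eq_succ_of_ne_zero hpos
  have hi' : 0 + 1 + (s : ZMod k) = i := by
    have := ZMod.natCast_zmod_val i
    rw [hs] at this
    rw [← this]
    push_cast
    ring
  rw [ZMod.natCast_zmod_val, zero_add, hs, segment_succ, hi', hb0, hbi] at hw
  refine ⟨segment b 0 s, hw, by simp [hs], hbr.nodup_segment 0 (by omega), ?_⟩
  intro y hy
  obtain ⟨t, ht, rfl⟩ := mem_segment.1 hy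
  have e : (0 : ZMod k) + 1 + (t : ZMod k) = ((t + 1 : ℕ) : ZMod k) := by push_cast; ring
  refine hbS _ ?_
  rw [e]
  simp only [Finset.mem_compl, Finset.mem_insert, Finset.mem_singleton, not_or]
  constructor
  · intro h
    have := natCast_zmod_inj (k := k) (s := t + 1) (t := 0) (by omega) (by omega) (by simpa using h)
    omega
  · intro h
    rw [← ZMod.natCast_zmod_val i] at h
    have := natCast_zmod_inj (by omega) hlt h
    omega

/-- From the `i`-th vertex of a member of a core one can walk to its root, in `k - i` steps, with
all intermediate vertices off a given small set. -/
theorem exists_walkVia_to_root (hE : G.IsCore D E) {a : ZMod k → V} (ha : a ∈ E) {i : ZMod k}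
    (hi : i ≠ 0) {S : Finset V} (hS : S.card ≤ D) :
    ∃ l, G.WalkVia (a i) (l ++ [a 0]) (a 0) ∧ l.length + 1 + i.val = k ∧ l.Nodup ∧
      ∀ y ∈ l, y ∉ S := by
  obtain ⟨b, hb, hba, hbS⟩ := hE.exists_notMem ha hS {0, i}ᶜ (by simp)
  have hb0 : b 0 = a 0 := hba 0 (by simp)
  have hbi : b i = a i := hba i (by simp)
  have hbr := (hE b hb).1
  have hlt := ZMod.val_lt i
  have hpos : i.val ≠ 0 := by simpa using hi
  obtain ⟨s, hs⟩ : ∃ s, s + 1 + i.val = k := ⟨k - i.val - 1, by omega⟩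
  have hw := hbr.walkVia_segment i (s + 1)
  have e0 : i + 1 + (s : ZMod k) = 0 := by
    have := congrArg (Nat.cast : ℕ → ZMod k) hs
    push_cast at this
    rw [ZMod.natCast_zmod_val, ZMod.natCast_self] at this
    rw [← this]
    ring
  have e1 : i + ((s + 1 : ℕ) : ZMod k) = 0 := by
    rw [← e0]
    push_cast
    ring
  rw [segment_succ, e0, e1, hb0, hbi] at hw
  refine ⟨segment b i s, hw, by simpa using hs, hbr.nodup_segment i (by omega), ?_⟩
  intro y hy
  obtain ⟨t, ht, rfl⟩ := mem_segment.1 hy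
  have e : i + 1 + (t : ZMod k) = ((i.val + t + 1 : ℕ) : ZMod k) := by
    push_cast
    rw [ZMod.natCast_zmod_val]
    ring
  refine hbS _ ?_
  rw [e]
  simp only [Finset.mem_compl, Finset.mem_insert, Finset.mem_singleton, not_or]
  constructor
  · intro h
    have := natCast_zmod_inj (k := k) (s := i.val + t + 1) (t := 0) (by omega) (by omega)
      (by simpa using h)
    omega
  · intro h
    rw [← ZMod.natCast_zmod_val i] at h
    have := natCast_zmod_inj (by rw [ZMod.natCast_zmod_val]; omega) (by omega) h
    rw [ZMod.natCast_zmod_val] at this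
    omega

/-- A vertex has at most one position in the members of a core with a given root. -/
theorem position_unique (hE : G.IsCore D E) (hG : G.CircumferenceLE k) (hD : k + 2 ≤ D)
    {a b : ZMod k → V} (ha : a ∈ E) (hb : b ∈ E) (h0 : a 0 = b 0) {i j : ZMod k} (hi : i ≠ 0)
    (hj : j ≠ 0) (hij : a i = b j) : i = j := by
  -- If `i` precedes `j`, go from the root to the common vertex in `j` steps and back in `k - i`
  -- steps, with disjoint interiors: a cycle longer than `k`.
  have key : ∀ {a b : ZMod k → V} (_ : a ∈ E) (_ : b ∈ E) (_ : a 0 = b 0) {i j : ZMod k}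
      (_ : i ≠ 0) (_ : j ≠ 0) (_ : a i = b j), ¬ i.val < j.val := by
    clear hij hi hj h0 ha hb a b i j
    intro a b ha hb h0 i j hi hj hij hlt
    obtain ⟨l₁, hw₁, hl₁, hn₁, hS₁⟩ :=
      hE.exists_walkVia_from_root hb hj (S := {b 0, b j}) (Finset.card_le_two.trans (by omega))
    have hjk := ZMod.val_lt j
    obtain ⟨l₂, hw₂, hl₂, hn₂, hS₂⟩ :=
      hE.exists_walkVia_to_root ha hi (S := {b 0, b j} ∪ l₁.toFinset)
        ((Finset.card_union_le _ _).trans (by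
          have h1 := List.toFinset_card_le l₁
          have h2 := Finset.card_le_two (a := b 0) (b := b j)
          omega))
    rw [h0, hij] at hw₂
    have hne : b j ≠ b 0 := fun h => hj ((hE b hb).1.1 h)
    have hlen := hG.length_le (hw₁.append hw₂) (by
      simp only [Finset.mem_insert, Finset.mem_singleton, Finset.mem_union, List.mem_toFinset,
        not_or] at hS₁ hS₂
      simp only [List.nodup_append, List.mem_append, List.mem_singleton, List.nodup_singleton]
      grind)
    simp only [List.length_append, List.length_singleton] at hlen
    omega
  have h1 := key ha hb h0 hi hj hij
  have h2 := key hb ha h0.symm hj hi hij.symm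
  exact ZMod.val_injective k (by omega)

end IsCore

/-! ### Branches of different roots are almost disjoint -/

variable [Fintype V]

/-- The vertices other than `v` of the members of `E` with root `v`. -/
def branch (E : Finset (ZMod k → V)) (v : V) : Finset V :=
  Finset.univ.filter fun x => ∃ a ∈ E, a 0 = v ∧ ∃ i, i ≠ 0 ∧ a i = x

theorem mem_branch {E : Finset (ZMod k → V)} {v x : V} :
    x ∈ branch E v ↔ ∃ a ∈ E, a 0 = v ∧ ∃ i, i ≠ 0 ∧ a i = x := by
  simp [branch]

namespace IsCore

variable {E : Finset (ZMod k → V)}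

theorem notMem_branch_self (hE : G.IsCore D E) (v : V) : v ∉ branch E v := by
  rw [mem_branch]
  rintro ⟨a, ha, h0, i, hi, hai⟩
  exact hi ((hE a ha).1.1 (hai.trans h0.symm))

/-- The branches of two distinct roots share at most one vertex. -/
theorem eq_of_mem_branch (hE : G.IsCore D E) (hG : G.CircumferenceLE k) (hD : 4 * k + 4 ≤ D)
    {u v x y : V} (huv : u ≠ v) (hxu : x ∈ branch E u) (hxv : x ∈ branch E v)
    (hyu : y ∈ branch E u) (hyv : y ∈ branch E v) : x = y := by
  by_contra hxy
  -- With `x` no later than `y` as seen from `v`, the cycle `v → y → u → x → v` has length `j + (k -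
  -- j') + i' + (k - i) > k`. The growing forbidden sets below keep its four pieces disjoint; `4 * k
  -- + 4 ≤ D` leaves room for them.
  wlog hle : ∃ a ∈ E, ∃ b ∈ E, a 0 = v ∧ b 0 = v ∧ ∃ i j : ZMod k, i ≠ 0 ∧ j ≠ 0 ∧ a i = x ∧
    b j = y ∧ i.val ≤ j.val generalizing x y
  · refine this hyu hyv hxu hxv (Ne.symm hxy) ?_
    obtain ⟨a, ha, ha0, i, hi, hai⟩ := mem_branch.1 hxv
    obtain ⟨b, hb, hb0, j, hj, hbj⟩ := mem_branch.1 hyv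
    refine ⟨b, hb, a, ha, hb0, ha0, j, i, hj, hi, hbj, hai, ?_⟩
    by_contra hlt
    exact hle ⟨a, ha, b, hb, ha0, hb0, i, j, hi, hj, hai, hbj, by omega⟩
  obtain ⟨a, ha, b, hb, ha0, hb0, i, j, hi, hj, hai, hbj, hij⟩ := hle
  obtain ⟨a', ha', ha0', i', hi', hai'⟩ := mem_branch.1 hxu
  obtain ⟨b', hb', hb0', j', hj', hbj'⟩ := mem_branch.1 hyu
  have hxu' : x ≠ u := fun h => hE.notMem_branch_self u (h ▸ hxu)
  have hxv' : x ≠ v := fun h => hE.notMem_branch_self v (h ▸ hxv)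
  have hyu' : y ≠ u := fun h => hE.notMem_branch_self u (h ▸ hyu)
  have hyv' : y ≠ v := fun h => hE.notMem_branch_self v (h ▸ hyv)
  set S : Finset V := {u, v, x, y} with hS
  have hSc : S.card ≤ 4 := Finset.card_le_four
  have hjk := ZMod.val_lt j
  have hjk' := ZMod.val_lt j'
  have hik := ZMod.val_lt i
  have hik' := ZMod.val_lt i'
  obtain ⟨l₁, hw₁, hl₁, hn₁, hS₁⟩ := hE.exists_walkVia_from_root hb hj (S := S) (by omega)
  have hc₁ := List.toFinset_card_le l₁
  have hd₁ := Finset.card_union_le S l₁.toFinset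
  obtain ⟨l₂, hw₂, hl₂, hn₂, hS₂⟩ := hE.exists_walkVia_to_root hb' hj' (S := S ∪ l₁.toFinset)
    (by omega)
  have hc₂ := List.toFinset_card_le l₂
  have hd₂ := Finset.card_union_le (S ∪ l₁.toFinset) l₂.toFinset
  obtain ⟨l₃, hw₃, hl₃, hn₃, hS₃⟩ := hE.exists_walkVia_from_root ha' hi'
    (S := S ∪ l₁.toFinset ∪ l₂.toFinset) (by omega)
  have hc₃ := List.toFinset_card_le l₃
  have hd₃ := Finset.card_union_le (S ∪ l₁.toFinset ∪ l₂.toFinset) l₃.toFinset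
  obtain ⟨l₄, hw₄, hl₄, hn₄, hS₄⟩ := hE.exists_walkVia_to_root ha hi
    (S := S ∪ l₁.toFinset ∪ l₂.toFinset ∪ l₃.toFinset) (by omega)
  rw [hb0, hbj] at hw₁
  rw [hb0', hbj'] at hw₂
  rw [ha0', hai'] at hw₃
  rw [ha0, hai] at hw₄
  have hlen := hG.length_le (((hw₁.append hw₂).append hw₃).append hw₄) (by
    simp only [hS, Finset.mem_insert, Finset.mem_singleton, Finset.mem_union, List.mem_toFinset,
      not_or] at hS₁ hS₂ hS₃ hS₄
    simp only [List.nodup_append, List.mem_append, List.mem_singleton, List.nodup_singleton]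
    grind)
  simp only [List.length_append, List.length_singleton] at hlen
  omega

/-- Some root of a nonempty set `R` of roots has a branch that meets the other branches in at most
`2 * k` vertices. -/
theorem exists_card_inter_biUnion_le (hE : G.IsCore D E) (hG : G.CircumferenceLE k)
    (hD : 4 * k + 4 ≤ D) (R : Finset V) (hR : R.Nonempty) :
    ∃ v ∈ R, (branch E v ∩ (R.erase v).biUnion (branch E)).card ≤ 2 * k := by
  by_contra! hcon
  -- Otherwise a path could go on from root to root, passing each time through a vertex shared by
  -- their branches.
  refine hG.false_of_extension (NeZero.one_le) (· ∈ R) hR ?_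
  intro v hv S hvS hS
  obtain ⟨x, hxv, u, hu, huv, hxu, hxS, huS⟩ : ∃ x ∈ branch E v, ∃ u ∈ R, u ≠ v ∧ x ∈ branch E u ∧
      x ∉ S ∧ u ∉ S := by
    -- More than `k` shared vertices lie outside `S`. If all their other roots were in `S`, two of
    -- these vertices would have the same one, against `eq_of_mem_branch`.
    by_contra! hno
    set X := (branch E v ∩ (R.erase v).biUnion (branch E)) \ S with hX
    have hXc : k < X.card := by
      have h1 := hcon v hv
      have h2 := Finset.le_card_sdiff S (branch E v ∩ (R.erase v).biUnion (branch E))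
      rw [hX]
      omega
    have hXm : ∀ x ∈ X, ∃ u, u ∈ S ∧ u ≠ v ∧ x ∈ branch E u ∧ x ∈ branch E v := by
      intro x hx
      simp only [hX, Finset.mem_sdiff, Finset.mem_inter, Finset.mem_biUnion,
        Finset.mem_erase] at hx
      obtain ⟨⟨hxv, u, ⟨huv, hu⟩, hxu⟩, hxS⟩ := hx
      exact ⟨u, hno x hxv u hu huv hxu hxS, huv, hxu, hxv⟩
    choose! f hf using hXm
    obtain ⟨x, hx, y, hy, hxy, hfxy⟩ := Finset.exists_ne_map_eq_of_card_lt_of_maps_to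
      (hS.trans_lt hXc) (f := f) (fun x hx => (hf x hx).1)
    refine hxy (hE.eq_of_mem_branch hG hD (hf x hx).2.1 (hf x hx).2.2.1 (hf x hx).2.2.2 ?_
      (hf y hy).2.2.2)
    rw [hfxy]
    exact (hf y hy).2.2.1
  obtain ⟨a, ha, ha0, i, hi, hai⟩ := mem_branch.1 hxv
  obtain ⟨b, hb, hb0, j, hj, hbj⟩ := mem_branch.1 hxu
  have hxu' : x ≠ u := fun h => hE.notMem_branch_self u (h ▸ hxu)
  have hik := ZMod.val_lt i
  have hc₀ := Finset.card_union_le S {x, u}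
  have hc₀' := Finset.card_le_two (a := x) (b := u)
  obtain ⟨l₁, hw₁, hl₁, hn₁, hS₁⟩ := hE.exists_walkVia_from_root ha hi (S := S ∪ {x, u}) (by omega)
  have hc₁ := List.toFinset_card_le l₁
  have hd₁ := Finset.card_union_le (S ∪ {x, u}) l₁.toFinset
  obtain ⟨l₂, hw₂, hl₂, hn₂, hS₂⟩ := hE.exists_walkVia_to_root hb hj
    (S := S ∪ {x, u} ∪ l₁.toFinset) (by omega)
  rw [ha0, hai] at hw₁
  rw [hb0, hbj] at hw₂
  simp only [Finset.mem_insert, Finset.mem_singleton, Finset.mem_union, List.mem_toFinset,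
    not_or] at hS₁ hS₂
  refine ⟨_, u, hw₁.append hw₂, by simp, ?_, ?_, hu⟩
  · simp only [List.nodup_append, List.mem_append, List.mem_singleton, List.nodup_singleton]
    grind
  · simp only [List.mem_append, List.mem_singleton]
    grind

/-- Remove a root whose branch has at most `2 * k` vertices in common with the others; the rest of
its branch is new to the union. -/
theorem sum_card_branch_le (hE : G.IsCore D E) (hG : G.CircumferenceLE k)
    (hD : 4 * k + 4 ≤ D) (R : Finset V) :
    ∑ v ∈ R, ((branch E v).card - 2 * k) ≤ (R.biUnion (branch E)).card := by
  induction R using Finset.strongInduction with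
  | H R ih =>
    rcases R.eq_empty_or_nonempty with rfl | hR
    · simp
    obtain ⟨v, hv, hcard⟩ := hE.exists_card_inter_biUnion_le hG hD R hR
    have h1 := ih _ (Finset.erase_ssubset hv)
    rw [← Finset.add_sum_erase _ _ hv]
    have h2 : R.biUnion (branch E) = branch E v ∪ (R.erase v).biUnion (branch E) := by
      rw [← Finset.biUnion_insert, Finset.insert_erase hv]
    rw [h2]
    have h3 := Finset.card_union_add_card_inter (branch E v) ((R.erase v).biUnion (branch E))
    have h4 := Finset.card_le_card
      (Finset.subset_union_right (s₁ := branch E v) (s₂ := (R.erase v).biUnion (branch E)))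
    omega

end IsCore

end Digraph

/-! ### Power inequalities -/

/-- A mean value estimate: a bounded shift of the base costs one power. It absorbs the loss of `2 *
k` per branch, the passage from `n` to `n - 1`, and the rounding in the lower bound. -/
theorem Nat.add_pow_succ_le (y d m : ℕ) :
    (y + d) ^ (m + 1) ≤ y ^ (m + 1) + (m + 1) * d * (y + d) ^ m := by
  induction m with
  | zero => simp
  | succ m ih =>
    have h1 : y ^ (m + 1) ≤ (y + d) ^ (m + 1) := Nat.pow_le_pow_left (Nat.le_add_right _ _) _
    calc (y + d) ^ (m + 1 + 1) = (y + d) * (y + d) ^ (m + 1) := by ring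
      _ ≤ (y + d) * (y ^ (m + 1) + (m + 1) * d * (y + d) ^ m) := Nat.mul_le_mul_left _ ih
      _ = y ^ (m + 1 + 1) + d * y ^ (m + 1) + (m + 1) * d * (y + d) ^ (m + 1) := by ring
      _ ≤ y ^ (m + 1 + 1) + d * (y + d) ^ (m + 1) + (m + 1) * d * (y + d) ^ (m + 1) := by gcongr
      _ = _ := by ring

/-- Superadditivity of powers: concentrating everything at a single root is optimal. -/
theorem Finset.sum_pow_succ_le_pow_sum {ι : Type*} (s : Finset ι) (b : ι → ℕ) (m : ℕ) :
    ∑ v ∈ s, b v ^ (m + 1) ≤ (∑ v ∈ s, b v) ^ (m + 1) := by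
  calc ∑ v ∈ s, b v ^ (m + 1) = ∑ v ∈ s, b v * b v ^ m := by simp only [pow_succ, mul_comm]
    _ ≤ ∑ v ∈ s, b v * (∑ w ∈ s, b w) ^ m := by
        refine Finset.sum_le_sum fun v hv => ?_
        gcongr
        exact Finset.single_le_sum (f := b) (fun _ _ => Nat.zero_le _) hv
    _ = _ := by rw [← Finset.sum_mul, pow_succ, mul_comm]

/-- The inequality of arithmetic and geometric means for natural numbers. -/
theorem Finset.card_pow_mul_prod_le {ι : Type*} (s : Finset ι) (x : ι → ℕ) :
    s.card ^ s.card * ∏ i ∈ s, x i ≤ (∑ i ∈ s, x i) ^ s.card := by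
  rcases s.eq_empty_or_nonempty with rfl | hs
  · simp
  have hm : (0 : ℝ) < s.card := by exact_mod_cast Finset.card_pos.2 hs
  have h := Real.geom_mean_le_arith_mean s (fun _ => 1) (fun i => (x i : ℝ))
    (fun _ _ => zero_le_one) (by simpa using hs) (fun _ _ => Nat.cast_nonneg _)
  simp only [Real.rpow_one, Finset.sum_const, nsmul_eq_mul, mul_one, one_mul] at h
  have h0 : (0 : ℝ) ≤ ∏ i ∈ s, (x i : ℝ) := Finset.prod_nonneg fun _ _ => Nat.cast_nonneg _
  have h1 := pow_le_pow_left₀ (Real.rpow_nonneg h0 _) h s.card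
  rw [Real.rpow_inv_natCast_pow h0 (Finset.card_pos.2 hs).ne', div_pow,
    le_div_iff₀ (by positivity), mul_comm] at h1
  exact_mod_cast h1

/-! ### Counting core cycles, then all cycles -/

namespace Digraph

variable {V : Type*} [Fintype V] [DecidableEq V] {G : Digraph V} {k : ℕ} [NeZero k] {D : ℕ}

namespace IsCore

variable {E : Finset (ZMod k → V)}

/-- By `position_unique` the sets of vertices occurring at the `k - 1` nonroot positions are
disjoint parts of the branch. A cycle rooted at `v` is a choice from each, and AM-GM bounds the
product of their sizes. -/
theorem pow_mul_card_filter_le (hE : G.IsCore D E) (hG : G.CircumferenceLE k) (hD : k + 2 ≤ D)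
    (v : V) :
    (k - 1) ^ (k - 1) * (E.filter fun a => a 0 = v).card ≤ (branch E v).card ^ (k - 1) := by
  classical
  set s : Finset (ZMod k) := Finset.univ.erase 0 with hs
  have hsc : s.card = k - 1 := by
    rw [hs, Finset.card_erase_of_mem (Finset.mem_univ _), Finset.card_univ, ZMod.card]
  set Ev := E.filter fun a => a 0 = v with hEv
  let Z : ZMod k → Finset V := fun i => Ev.image fun a => a i
  have hprod : Ev.card ≤ ∏ i ∈ s, (Z i).card := by
    rw [← Finset.card_pi]
    refine Finset.card_le_card_of_injOn (fun a i _ => a i) ?_ ?_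
    · intro a ha
      rw [Finset.mem_coe, Finset.mem_pi]
      intro i _
      exact Finset.mem_image_of_mem (fun a => a i) ha
    · intro a ha b hb hab
      funext i
      by_cases hi : i = 0
      · subst hi
        rw [(Finset.mem_filter.1 ha).2, (Finset.mem_filter.1 hb).2]
      · exact congrFun (congrFun hab i) (by simp [hs, hi])
  have hsum : ∑ i ∈ s, (Z i).card ≤ (branch E v).card := by
    rw [← Finset.card_biUnion]
    · refine Finset.card_le_card fun x hx => ?_
      obtain ⟨i, hi, hx⟩ := Finset.mem_biUnion.1 hx
      obtain ⟨a, ha, rfl⟩ := Finset.mem_image.1 hx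
      obtain ⟨haE, ha0⟩ := Finset.mem_filter.1 ha
      exact mem_branch.2 ⟨a, haE, ha0, i, Finset.ne_of_mem_erase hi, rfl⟩
    · intro i hi j hj hij
      refine Finset.disjoint_left.2 fun x hx hx' => hij ?_
      obtain ⟨a, ha, rfl⟩ := Finset.mem_image.1 hx
      obtain ⟨b, hb, hab⟩ := Finset.mem_image.1 hx'
      obtain ⟨haE, ha0⟩ := Finset.mem_filter.1 ha
      obtain ⟨hbE, hb0⟩ := Finset.mem_filter.1 hb
      exact hE.position_unique hG hD haE hbE (ha0.trans hb0.symm) (Finset.ne_of_mem_erase hi)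
        (Finset.ne_of_mem_erase hj) hab.symm
  calc (k - 1) ^ (k - 1) * Ev.card ≤ s.card ^ s.card * ∏ i ∈ s, (Z i).card := by
        rw [hsc]; gcongr
    _ ≤ (∑ i ∈ s, (Z i).card) ^ s.card := s.card_pow_mul_prod_le _
    _ ≤ _ := by rw [hsc]; gcongr

/-- The substitutes for `a 1` alone are enough. This makes the truncated difference `(branch E
v).card - 2 * k` positive for every root occurring in `E`. -/
theorem lt_card_branch (hE : G.IsCore D E) (hk : 2 ≤ k) {a : ZMod k → V} (ha : a ∈ E) :
    D < (branch E (a 0)).card := by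
  have : Fact (1 < k) := ⟨by omega⟩
  refine ((hE a ha).2 1 one_ne_zero).trans_le ?_
  refine Finset.card_le_card_of_injOn (fun b => b 1) ?_ ?_
  · intro b hb
    obtain ⟨hbE, hba⟩ := Finset.mem_filter.1 hb
    exact mem_branch.2 ⟨b, hbE, hba 0 zero_ne_one, 1, one_ne_zero, rfl⟩
  · intro b hb c hc hbc
    have hb := (Finset.mem_filter.1 hb).2
    have hc := (Finset.mem_filter.1 hc).2
    funext j
    by_cases hj : j = 1
    · subst hj; exact hbc
    · rw [hb j hj, hc j hj]

theorem pow_mul_card_le (hE : G.IsCore D E) (hG : G.CircumferenceLE k) (hk : 3 ≤ k)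
    (hD : 4 * k + 4 ≤ D) :
    (k - 1) ^ (k - 1) * E.card ≤ Fintype.card V ^ (k - 1) +
      (k - 1) * (2 * k) * (1 + 2 * k) ^ (k - 2) * Fintype.card V ^ (k - 2) := by
  classical
  obtain ⟨r, hr⟩ : ∃ r, k = r + 3 := ⟨k - 3, by omega⟩
  have hr1 : k - 1 = r + 1 + 1 := by omega
  have hr2 : k - 2 = r + 1 := by omega
  set R := E.image fun a => a 0 with hR
  set b : V → ℕ := fun v => (branch E v).card - 2 * k with hb
  have hbn : ∑ v ∈ R, b v ≤ Fintype.card V :=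
    (hE.sum_card_branch_le hG hD R).trans (Finset.card_le_univ _)
  have hv : ∀ v ∈ R, (k - 1) ^ (k - 1) * (E.filter fun a => a 0 = v).card ≤
      b v ^ (r + 1 + 1) + (k - 1) * (2 * k) * (1 + 2 * k) ^ (r + 1) * b v ^ (r + 1) := by
    intro v hv
    obtain ⟨a, ha, rfl⟩ := Finset.mem_image.1 hv
    have h1 := hE.lt_card_branch (by omega) ha
    have h2 : (branch E (a 0)).card = b (a 0) + 2 * k := by simp only [hb]; omega
    have h3 : 1 ≤ b (a 0) := by omega
    refine (hE.pow_mul_card_filter_le hG (by omega) _).trans ?_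
    rw [h2, hr1]
    refine (Nat.add_pow_succ_le _ _ _).trans ?_
    refine Nat.add_le_add_left ?_ _
    -- As `b (a 0) ≥ 1`, one has `b (a 0) + 2 * k ≤ (1 + 2 * k) * b (a 0)`; the error thus becomes a
    -- pure power, to which superadditivity applies.
    rw [mul_assoc _ (_ ^ _), ← mul_pow]
    gcongr
    nlinarith
  calc (k - 1) ^ (k - 1) * E.card
      = ∑ v ∈ R, (k - 1) ^ (k - 1) * (E.filter fun a => a 0 = v).card := by
        rw [← Finset.mul_sum, ← Finset.card_eq_sum_card_image]
    _ ≤ ∑ v ∈ R, (b v ^ (r + 1 + 1) +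
          (k - 1) * (2 * k) * (1 + 2 * k) ^ (r + 1) * b v ^ (r + 1)) := Finset.sum_le_sum hv
    _ ≤ (∑ v ∈ R, b v) ^ (r + 1 + 1) +
          (k - 1) * (2 * k) * (1 + 2 * k) ^ (r + 1) * (∑ v ∈ R, b v) ^ (r + 1) := by
        rw [Finset.sum_add_distrib, ← Finset.mul_sum]
        gcongr
        · exact R.sum_pow_succ_le_pow_sum b _
        · exact R.sum_pow_succ_le_pow_sum b _
    _ ≤ _ := by
        rw [hr2, hr1]
        gcongr

end IsCore

/-- The number of rooted `k`-cycles without a rotation in the largest core is `O(n ^ (k - 2))`. -/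
theorem CircumferenceLE.card_le_of_rotate_notMem_maxCore (hG : G.CircumferenceLE k) (hk : 3 ≤ k)
    (hD : 2 * k ≤ D) (N : Finset (ZMod k → V)) (hN : ∀ a ∈ N, G.IsRootedCycle a)
    (hrot : ∀ a ∈ N, ∀ r : ZMod k, (fun i => a (i + r)) ∉ G.maxCore D k) :
    N.card ≤ (2 * k * D) ^ k * (2 * D * k ^ 2 * Fintype.card V ^ (k - 2)) := by
  classical
  by_contra! hcon
  obtain ⟨p, F, hF, ⟨a₀, ha₀⟩, hheavy⟩ := hG.exists_heavy_off_one hk hD N hN hcon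
  have hinj : Function.Injective fun (a : ZMod k → V) (i : ZMod k) => a (i + p) := by
    intro a b hab
    funext i
    have := congrFun hab (i - p)
    simpa using this
  -- Rotating the one possibly rigid position `p` to the root turns `F` into a core.
  have hcore : G.IsCore D (F.image fun a i => a (i + p)) := by
    intro a' ha'
    obtain ⟨a, ha, rfl⟩ := Finset.mem_image.1 ha'
    refine ⟨(hN a (hF ha)).rotate p, fun i hi => ?_⟩
    refine (hheavy a ha (i + p) (by simpa using hi)).trans_le ?_
    refine Finset.card_le_card_of_injOn (fun a i => a (i + p)) ?_ hinj.injOn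
    intro b hb
    obtain ⟨hbF, hba⟩ := Finset.mem_filter.1 hb
    refine Finset.mem_filter.2 ⟨Finset.mem_image_of_mem _ hbF, fun j hj => ?_⟩
    exact hba _ (by simpa using hj)
  exact hrot a₀ (hF ha₀) p (hcore.subset_maxCore (Finset.mem_image_of_mem _ ha₀))

/-- A cycle is shorter than `k`, or has a rotation in the largest core, or is exceptional; the first
and third kinds make up the error term. -/
theorem CircumferenceLE.ncard_directedCycles_le (hG : G.CircumferenceLE k)
    (h2 : ∀ c ∈ G.directedCycles, 2 ≤ c.length) (hD : 2 * k ≤ D) (hk : 3 ≤ k) [Nonempty V] :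
    G.directedCycles.ncard ≤ (G.maxCore D k).card +
      (k ^ 3 + (2 * k * D) ^ k * (2 * D * k ^ 2)) * Fintype.card V ^ (k - 2) := by
  classical
  set N : Finset (ZMod k → V) := Finset.univ.filter fun a => G.IsRootedCycle a ∧
    ∀ r : ZMod k, (fun i => a (i + r)) ∉ G.maxCore D k with hN
  have hNc := hG.card_le_of_rotate_notMem_maxCore hk hD N (fun a ha => (Finset.mem_filter.1 ha).2.1)
    (fun a ha => (Finset.mem_filter.1 ha).2.2)
  set A : ℕ → Finset (Cycle V) := fun i =>
    (Finset.univ.filter fun a : ZMod (i + 2) → V => G.IsRootedCycle a).image toCycle with hA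
  have hAc : ∀ i ∈ Finset.range (k - 2), (A i).card ≤ k ^ 2 * Fintype.card V ^ (k - 2) := by
    intro i hi
    rw [Finset.mem_range] at hi
    refine Finset.card_image_le.trans ?_
    refine (hG.card_rooted_le (by omega) (by omega) _ fun a ha => (Finset.mem_filter.1 ha).2).trans
      ?_
    rw [sq, mul_assoc]
    refine Nat.mul_le_mul_left _ (Nat.mul_le_mul (by omega) ?_)
    exact Nat.pow_le_pow_right Fintype.card_pos (by omega)
  have hsub : G.directedCycles ⊆
      (((Finset.range (k - 2)).biUnion A ∪ (G.maxCore D k).image toCycle) ∪ N.image toCycle :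
        Finset (Cycle V)) := by
    intro c hc
    have hc2 := h2 c hc
    have hck := hG c hc
    simp only [Finset.coe_union, Set.mem_union, Finset.mem_coe, Finset.mem_biUnion,
      Finset.mem_range, Finset.mem_image]
    rcases hck.lt_or_eq with hlt | heq
    · obtain ⟨a, ha, hac⟩ := exists_isRootedCycle (k := (c.length - 2) + 2) hc (by omega)
      exact .inl (.inl ⟨c.length - 2, by omega,
        Finset.mem_image.2 ⟨a, Finset.mem_filter.2 ⟨Finset.mem_univ _, ha⟩, hac⟩⟩)
    · obtain ⟨a, ha, rfl⟩ := exists_isRootedCycle hc heq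
      by_cases hr : ∀ r : ZMod k, (fun i => a (i + r)) ∉ G.maxCore D k
      · exact .inr ⟨a, Finset.mem_filter.2 ⟨Finset.mem_univ _, ha, hr⟩, rfl⟩
      · push Not at hr
        obtain ⟨r, hr⟩ := hr
        exact .inl (.inr ⟨_, hr, toCycle_rotate a r⟩)
  have h3 := Set.ncard_le_ncard hsub (Finset.finite_toSet _)
  rw [Set.ncard_coe_finset] at h3
  refine h3.trans ((Finset.card_union_le _ _).trans ?_)
  have h4 : ((Finset.range (k - 2)).biUnion A).card ≤ k ^ 3 * Fintype.card V ^ (k - 2) := by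
    refine Finset.card_biUnion_le.trans ((Finset.sum_le_card_nsmul _ _ _ hAc).trans ?_)
    rw [Finset.card_range, smul_eq_mul, ← mul_assoc]
    gcongr
    calc (k - 2) * k ^ 2 ≤ k * k ^ 2 := by gcongr; omega
      _ = k ^ 3 := by ring
  have h5 := Finset.card_union_le ((Finset.range (k - 2)).biUnion A)
    ((G.maxCore D k).image toCycle)
  have h6 : ((G.maxCore D k).image toCycle).card ≤ _ := Finset.card_image_le
  have h7 : (N.image toCycle).card ≤ _ := Finset.card_image_le
  rw [add_mul, mul_assoc ((2 * k * D) ^ k)]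
  omega

end Digraph

/-! ### The case `k = 2` -/

namespace Digraph

section TwoCycles

variable {V : Type*} {G : Digraph V}

theorem exists_eq_pair_of_mem_directedCycles {c : Cycle V} (hc : c ∈ G.directedCycles)
    (h2 : c.length = 2) {w : V} (hw : w ∈ c) :
    ∃ x, x ≠ w ∧ G.Adj w x ∧ c = (([w, x] : List V) : Cycle V) := by
  obtain ⟨-, hn, hch⟩ := hc
  induction c using Quotient.inductionOn' with
  | h l =>
    obtain ⟨l₁, l₂, rfl⟩ := List.append_of_mem (Cycle.mem_coe_iff.1 hw)
    have hrot : ((l₁ ++ w :: l₂ : List V) : Cycle V) = (w :: (l₂ ++ l₁) : List V) :=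
      Cycle.coe_eq_coe.2 List.isRotated_append
    change ((l₁ ++ w :: l₂ : List V) : Cycle V).length = 2 at h2
    change ((l₁ ++ w :: l₂ : List V) : Cycle V).Nodup at hn
    change ((l₁ ++ w :: l₂ : List V) : Cycle V).Chain G.Adj at hch
    change ∃ x, x ≠ w ∧ G.Adj w x ∧ ((l₁ ++ w :: l₂ : List V) : Cycle V) = _
    rw [hrot] at h2 hn hch ⊢
    obtain ⟨x, hx⟩ : ∃ x, l₂ ++ l₁ = [x] := by
      rw [← List.length_eq_one_iff]
      simpa using h2
    rw [hx] at h2 hn hch ⊢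
    rw [Cycle.chain_coe_cons] at hch
    rw [Cycle.nodup_coe_iff] at hn
    refine ⟨x, ?_, ?_, rfl⟩
    · rintro rfl; simp at hn
    · simp at hch; exact hch.1

/-- If all directed cycles have length `2`, then there are at most as many as vertices. -/
theorem ncard_directedCycles_le_card [Fintype V] (h : ∀ c ∈ G.directedCycles, c.length = 2) :
    G.directedCycles.ncard ≤ Fintype.card V := by
  classical
  by_contra! hcon
  have hfin := G.finite_directedCycles
  rw [Set.ncard_eq_toFinset_card _ hfin] at hcon
  obtain ⟨F, hF, ⟨c₀, hc₀⟩, hall⟩ := hfin.toFinset.exists_subset_forall_lt_card_filter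
    (Finset.univ : Finset V) (fun c v => v ∈ c) 1 (by simpa using hcon)
  have hF' : ∀ c ∈ F, c ∈ G.directedCycles := fun c hc => by simpa using hF hc
  have hG : G.CircumferenceLE 2 := fun c hc => (h c hc).le
  refine hG.false_of_extension (by omega) (fun w => ∃ c ∈ F, w ∈ c) ?_ ?_
  · have : c₀ ≠ Cycle.nil := (hF' _ hc₀).1
    induction c₀ using Cycle.induction_on with
    | nil => exact absurd rfl this
    | cons a l _ => exact ⟨a, _, hc₀, by simp⟩
  rintro w ⟨c, hc, hw⟩ S hwS hS
  -- Two 2-cycles of `F` pass through `w`, with different partners; `S` contains `w` and at most one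
  -- more vertex, so it misses a partner.
  obtain ⟨c₁, h₁, c₂, h₂, hne⟩ := Finset.one_lt_card.1 (hall c hc w (Finset.mem_univ _) hw)
  rw [Finset.mem_filter] at h₁ h₂
  have key : ∀ c ∈ F, w ∈ c → ∀ x, x ∉ S → G.Adj w x → c = (([w, x] : List V) : Cycle V) →
      ∃ l w', G.WalkVia w l w' ∧ l ≠ [] ∧ l.Nodup ∧ (∀ y ∈ l, y ∉ S) ∧ ∃ c ∈ F, w' ∈ c := by
    rintro c hc - x hx hadj rfl
    exact ⟨[x], x, .single hadj, by simp, by simp, by simpa using hx, _, hc, by simp⟩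
  obtain ⟨x₁, hx₁, ha₁, hc₁⟩ := exists_eq_pair_of_mem_directedCycles (hF' _ h₁.1)
    (h _ (hF' _ h₁.1)) h₁.2
  obtain ⟨x₂, hx₂, ha₂, hc₂⟩ := exists_eq_pair_of_mem_directedCycles (hF' _ h₂.1)
    (h _ (hF' _ h₂.1)) h₂.2
  by_cases hS₁ : x₁ ∈ S
  · by_cases hS₂ : x₂ ∈ S
    · exfalso
      have hsub : ({w, x₁, x₂} : Finset V) ⊆ S := by
        intro y hy
        simp only [Finset.mem_insert, Finset.mem_singleton] at hy
        rcases hy with rfl | rfl | rfl <;> assumption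
      have h12 : x₁ ≠ x₂ := by
        rintro rfl
        exact hne (hc₁.trans hc₂.symm)
      have := Finset.card_le_card hsub
      rw [Finset.card_eq_three.2 ⟨w, x₁, x₂, hx₁.symm, hx₂.symm, h12, rfl⟩] at this
      omega
    · exact key _ h₂.1 h₂.2 x₂ hS₂ ha₂ hc₂
  · exact key _ h₁.1 h₁.2 x₁ hS₁ ha₁ hc₁

end TwoCycles

/-! ### The layered construction for the lower bound -/

section Layered

variable {V : Type*} {k : ℕ}

/-- The digraph with an arc from each layer of `f` to the next one, cyclically. -/
def layered (f : V → ZMod k) : Digraph V := ⟨fun x y => f y = f x + 1⟩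

/-- Each arc raises the layer by one, so `k` divides the length. A cycle meets layer 0 again after
`k` steps, at the same vertex `v₀`, so the length divides `k`. -/
theorem length_eq_of_mem_directedCycles_layered [NeZero k] {f : V → ZMod k} {v₀ : V}
    (hf : ∀ x, f x = 0 → x = v₀) {c : Cycle V} (hc : c ∈ (layered f).directedCycles) :
    c.length = k := by
  have hm0 : c.length ≠ 0 := by
    have := hc.1
    induction c using Cycle.induction_on with
    | nil => exact absurd rfl this
    | cons a l _ => simp
  have : NeZero c.length := ⟨hm0⟩
  obtain ⟨a, ⟨hinj, ha⟩, -⟩ := exists_isRootedCycle hc rfl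
  have hstep : ∀ t : ℕ, f (a t) = f (a 0) + t := by
    intro t
    induction t with
    | zero => simp
    | succ t ih =>
      have : f (a (t + 1)) = f (a t) + 1 := ha t
      push_cast
      rw [this, ih]
      ring
  have h1 : k ∣ c.length := by
    have := hstep c.length
    rw [ZMod.natCast_self] at this
    rw [← ZMod.natCast_eq_zero_iff]
    simpa using this
  have h2 : c.length ∣ k := by
    have e1 := hf _ ((hstep (-f (a 0)).val).trans (by simp))
    have e2 := hf _ ((hstep ((-f (a 0)).val + k)).trans (by simp))
    have := hinj (e2.trans e1.symm)
    rw [← ZMod.natCast_eq_zero_iff]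
    simpa using this
  exact Nat.dvd_antisymm h2 h1

/-- One vertex from each layer makes a rooted cycle; the common root `v₀` keeps different choices
from giving the same cycle. -/
theorem prod_card_fiber_le_ncard_layered [Fintype V] [NeZero k] {f : V → ZMod k} {v₀ : V}
    (hf : ∀ x, f x = 0 → x = v₀) [∀ i, DecidablePred fun x => f x = i] :
    ∏ i, (Finset.univ.filter fun x => f x = i).card ≤ (layered f).directedCycles.ncard := by
  classical
  rw [← Fintype.card_piFinset, ← Set.ncard_coe_finset]
  have hmem : ∀ a ∈ Fintype.piFinset fun i => Finset.univ.filter fun x => f x = i,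
      ∀ i, f (a i) = i := fun a ha i => by
    simpa using Fintype.mem_piFinset.1 ha i
  have hroot : ∀ a ∈ Fintype.piFinset fun i => Finset.univ.filter fun x => f x = i,
      (layered f).IsRootedCycle a := by
    intro a ha
    refine ⟨fun i j hij => ?_, fun i => ?_⟩
    · rw [← hmem a ha i, ← hmem a ha j, hij]
    · change f (a (i + 1)) = f (a i) + 1
      rw [hmem a ha, hmem a ha]
  refine Set.ncard_le_ncard_of_injOn toCycle ?_ ?_ (layered f).finite_directedCycles
  · intro a ha
    exact (hroot a ha).toCycle_mem
  · intro a ha b hb hab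
    refine (hroot a ha).eq_of_toCycle_eq hab ?_
    rw [hf _ (hmem a ha 0), hf _ (hmem b hb 0)]

end Layered

end Digraph

theorem pow_le_maxDirectedCycles {L : Set ℕ} {k : ℕ} (hk : k ∈ L) (hk2 : 2 ≤ k) {n q : ℕ}
    (hn : q * (k - 1) + 1 ≤ n) : q ^ (k - 1) ≤ maxDirectedCycles L n := by
  classical
  have : NeZero k := ⟨by omega⟩
  have : Fact (1 < k) := ⟨by omega⟩
  -- Vertex 0 is alone in layer 0; the others are dealt out cyclically to layers `1, …, k - 1`.
  let g : ℕ → ℕ := fun x => if x = 0 then 0 else (x - 1) % (k - 1) + 1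
  have hg : ∀ x, g x < k := by
    intro x
    have := Nat.mod_lt (x - 1) (show 0 < k - 1 by omega)
    simp only [g]
    split_ifs <;> omega
  let f : Fin n → ZMod k := fun x => (g x : ZMod k)
  have hf : ∀ x, f x = 0 → x = ⟨0, by omega⟩ := by
    intro x hx
    have h1 : g x = 0 :=
      Digraph.natCast_zmod_inj (k := k) (hg x) (by omega) (by simpa [f] using hx)
    refine Fin.ext ?_
    by_contra h
    simp only [g, if_neg h] at h1
    omega
  have hfib : ∀ i : ZMod k, i ≠ 0 → q ≤ (Finset.univ.filter fun x => f x = i).card := by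
    intro i hi
    have hik := ZMod.val_lt i
    have hi0 : i.val ≠ 0 := by simpa using hi
    have hlt : ∀ t : Fin q, i.val + t * (k - 1) < n := by
      intro t
      have := Nat.mul_le_mul_right (k - 1) (show t.val + 1 ≤ q from t.2)
      rw [add_mul] at this
      omega
    conv_lhs => rw [← Fintype.card_fin q, ← Finset.card_univ]
    refine Finset.card_le_card_of_injOn (fun t => ⟨i.val + t * (k - 1), hlt t⟩) ?_ ?_
    · intro t _
      simp only [Finset.coe_filter, Finset.mem_univ, true_and, Set.mem_ofPred_eq, f, g]
      rw [if_neg (by omega), show i.val + t * (k - 1) - 1 = i.val - 1 + t * (k - 1) by omega,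
        Nat.add_mul_mod_self_right, Nat.mod_eq_of_lt (by omega),
        show i.val - 1 + 1 = i.val by omega, ZMod.natCast_zmod_val]
    · intro s _ t _ hst
      simp only [Fin.mk.injEq, Nat.add_left_cancel_iff] at hst
      exact Fin.ext (Nat.eq_of_mul_eq_mul_right (by omega) hst)
  have hprod : q ^ (k - 1) ≤ ∏ i, (Finset.univ.filter fun x => f x = i).card := by
    rw [← Finset.mul_prod_erase _ _ (Finset.mem_univ (0 : ZMod k))]
    have h0 : 1 ≤ (Finset.univ.filter fun x => f x = 0).card := by
      refine Finset.card_pos.2 ⟨⟨0, by omega⟩, ?_⟩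
      simp [f, g]
    have h1 : q ^ (k - 1) ≤
        ∏ i ∈ Finset.univ.erase (0 : ZMod k), (Finset.univ.filter fun x => f x = i).card := by
      have := Finset.prod_le_prod' (s := Finset.univ.erase (0 : ZMod k)) (f := fun _ => q)
        fun i hi => hfib i (Finset.ne_of_mem_erase hi)
      rwa [Finset.prod_const, Finset.card_erase_of_mem (Finset.mem_univ _), Finset.card_univ,
        ZMod.card] at this
    exact h1.trans (Nat.le_mul_of_pos_left _ h0)
  refine (hprod.trans (Digraph.prod_card_fiber_le_ncard_layered hf)).trans ?_
  refine (isGreatest_maxDirectedCycles L n).2 ⟨_, ⟨fun v hv => ?_, fun c hc => ?_⟩, rfl⟩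
  · have : f v = f v + 1 := hv
    simp at this
  · rwa [Digraph.length_eq_of_mem_directedCycles_layered hf hc]

/-! ### Assembling the asymptotic formula -/

theorem exists_maxDirectedCycles_le (L : Set ℕ) (k : ℕ) (hL : ∀ l ∈ L, 2 ≤ l)
    (hk : IsGreatest L k) : ∃ C : ℕ, ∀ n : ℕ, 1 ≤ n →
      (k - 1) ^ (k - 1) * maxDirectedCycles L n ≤ (n - 1) ^ (k - 1) + C * n ^ (k - 2) := by
  have hk2 := hL k hk.1
  rcases hk2.eq_or_lt with rfl | hk3
  · refine ⟨1, fun n hn => ?_⟩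
    obtain ⟨G, ⟨-, hG⟩, hGn⟩ := (isGreatest_maxDirectedCycles L n).1
    have := G.ncard_directedCycles_le_card fun c hc =>
      le_antisymm (hk.2 (hG c hc)) (hL _ (hG c hc))
    rw [hGn, Fintype.card_fin] at this
    simp only [Nat.add_one_sub_one, pow_one, one_mul, Nat.sub_self, pow_zero]
    omega
  · have : NeZero k := ⟨by omega⟩
    obtain ⟨D, hD⟩ : ∃ D, D = 4 * k + 4 := ⟨_, rfl⟩
    obtain ⟨A, hA⟩ : ∃ A, A = (k - 1) * (2 * k) * (1 + 2 * k) ^ (k - 2) := ⟨_, rfl⟩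
    obtain ⟨B, hB⟩ : ∃ B, B = k ^ 3 + (2 * k * D) ^ k * (2 * D * k ^ 2) := ⟨_, rfl⟩
    -- The three terms pay for replacing `n` by `n - 1`, for the overlaps of branches, and for the
    -- cycles outside the core.
    refine ⟨(k - 1) + A + (k - 1) ^ (k - 1) * B, fun n hn => ?_⟩
    obtain ⟨G, ⟨-, hG⟩, hGn⟩ := (isGreatest_maxDirectedCycles L n).1
    have hcirc : G.CircumferenceLE k := fun c hc => hk.2 (hG c hc)
    have : Nonempty (Fin n) := ⟨⟨0, hn⟩⟩
    have h1 := hcirc.ncard_directedCycles_le (D := D) (fun c hc => hL _ (hG c hc)) (by omega) hk3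
    have h2 := (Digraph.isCore_maxCore (G := G) (D := D) (k := k)).pow_mul_card_le hcirc hk3
      (by omega)
    rw [hGn, Fintype.card_fin, ← hB] at h1
    rw [Fintype.card_fin, ← hA] at h2
    have h3 : n ^ (k - 1) ≤ (n - 1) ^ (k - 1) + (k - 1) * n ^ (k - 2) := by
      have := Nat.add_pow_succ_le (n - 1) 1 (k - 2)
      rwa [Nat.sub_add_cancel hn, mul_one, show k - 2 + 1 = k - 1 by omega] at this
    calc (k - 1) ^ (k - 1) * maxDirectedCycles L n
        ≤ (k - 1) ^ (k - 1) * ((G.maxCore D k).card + B * n ^ (k - 2)) := by gcongr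
      _ = (k - 1) ^ (k - 1) * (G.maxCore D k).card + (k - 1) ^ (k - 1) * B * n ^ (k - 2) := by ring
      _ ≤ ((n - 1) ^ (k - 1) + (k - 1) * n ^ (k - 2)) + A * n ^ (k - 2) +
            (k - 1) ^ (k - 1) * B * n ^ (k - 2) := by
          have := h2.trans (Nat.add_le_add_right h3 _)
          omega
      _ = _ := by ring

theorem theorem4 (L : Set ℕ) (k : ℕ) (hL : ∀ l ∈ L, 2 ≤ l) (hk : IsGreatest L k) :
    (fun n : ℕ => (maxDirectedCycles L n : ℝ) - (((n : ℝ) - 1) / ((k : ℝ) - 1)) ^ (k - 1))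
      =O[Filter.atTop] (fun n : ℕ => (n : ℝ) ^ (k - 2)) := by
  have hk2 := hL k hk.1
  obtain ⟨C, hC⟩ := exists_maxDirectedCycles_le L k hL hk
  obtain ⟨m, rfl⟩ : ∃ m, k = m + 2 := ⟨k - 2, by omega⟩
  -- `m + 1` covers the rounding of `(n - 1) / (k - 1)` in the lower bound, `C` the error of the
  -- upper bound.
  refine Asymptotics.IsBigO.of_bound ((m : ℝ) + 1 + C) ?_
  filter_upwards [Filter.eventually_ge_atTop 1] with n hn
  obtain ⟨p, rfl⟩ : ∃ p, n = p + 1 := ⟨n - 1, by omega⟩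
  have hup := hC (p + 1) hn
  set q := p / (m + 1) with hq
  have hqp : q * (m + 1) ≤ p := Nat.div_mul_le_self p (m + 1)
  have hlt : p < (m + 1) * (q + 1) := Nat.lt_mul_div_succ p (Nat.succ_pos m)
  have hlow : q ^ (m + 1) ≤ maxDirectedCycles L (p + 1) :=
    pow_le_maxDirectedCycles hk.1 hk2 (by simpa using hqp)
  have hqn : q ≤ p := Nat.div_le_self _ _
  have hpow := Nat.add_pow_succ_le q 1 m
  set M := maxDirectedCycles L (p + 1)
  have e1 : m + 2 - 1 = m + 1 := rfl
  have e2 : m + 2 - 2 = m := rfl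
  have e3 : p + 1 - 1 = p := rfl
  rw [e1, e2, e3] at hup
  have hup' : ((m : ℝ) + 1) ^ (m + 1) * M ≤ (p : ℝ) ^ (m + 1) + C * ((p : ℝ) + 1) ^ m := by
    exact_mod_cast hup
  have hlow' : (q : ℝ) ^ (m + 1) ≤ M := by exact_mod_cast hlow
  have hpow' : ((q : ℝ) + 1) ^ (m + 1) ≤ (q : ℝ) ^ (m + 1) + (m + 1) * ((q : ℝ) + 1) ^ m := by
    have : (q + 1) ^ (m + 1) ≤ q ^ (m + 1) + (m + 1) * (q + 1) ^ m := by simpa using hpow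
    exact_mod_cast this
  have hqn' : (q : ℝ) ≤ p := by exact_mod_cast hqn
  have hm : (1 : ℝ) ≤ ((m : ℝ) + 1) ^ (m + 1) := one_le_pow₀ (by simp)
  have hdiv : (p : ℝ) / (m + 1) ≤ q + 1 := by
    rw [div_le_iff₀ (by positivity), mul_comm]
    exact_mod_cast hlt.le
  have hP : (0 : ℝ) ≤ ((p : ℝ) + 1) ^ m := by positivity
  have h1 : ((p : ℝ) / (m + 1)) ^ (m + 1) ≤ (q + 1) ^ (m + 1) := by gcongr
  have h2 : ((q : ℝ) + 1) ^ m ≤ (p + 1) ^ m := by gcongr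
  -- Dividing by `(m + 1) ^ (m + 1) ≥ 1` does not increase the error term.
  have h3 : (M : ℝ) ≤ ((p : ℝ) / (m + 1)) ^ (m + 1) + C * (p + 1) ^ m := by
    rw [div_pow, ← sub_le_iff_le_add, le_div_iff₀ (by positivity)]
    have := mul_le_mul_of_nonneg_left hm (show (0 : ℝ) ≤ C * (p + 1) ^ m by positivity)
    nlinarith
  rw [e1, e2]
  have e4 : (((p + 1 : ℕ) : ℝ) - 1) / (((m + 2 : ℕ) : ℝ) - 1) = (p : ℝ) / (m + 1) := by
    push_cast
    congr 1
    · ring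
    · ring
  rw [e4, Real.norm_eq_abs, Real.norm_of_nonneg (by positivity)]
  push_cast
  have h4 : ((m : ℝ) + 1) * ((q : ℝ) + 1) ^ m ≤ (m + 1) * (p + 1) ^ m := by gcongr
  have h5 : 0 ≤ ((m : ℝ) + 1) * ((p : ℝ) + 1) ^ m := by positivity
  have h6 : 0 ≤ (C : ℝ) * ((p : ℝ) + 1) ^ m := by positivity
  rw [abs_le]
  constructor <;> nlinarith
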